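/- Let $-\infty<a<b<\infty$, $\Omega=(a,b)$, and $\delta_\Omega(x)=\operatorname{dist}(x,\partial\Omega)$. Let $K,M\in L^2(\Omega)$ with $K,M\ge 0$ a.e. and $K\not\equiv 0$, and set $M_a(x)=(x-a)M(x)$, $M_b(x)=(b-x)M(x)$. For $\gamma>0$ and $\lambda>0$ consider the problem $$(P_{\gamma,\lambda})\qquad -u''=K(x)u^{-\gamma}-\lambda M(x)u^{-\gamma}\ \text{ in }\Omega,\qquad u>0\ \text{ in }\Omega,\qquad u(a)=u(b)=0.$$ A solution is a function $u\in C^1(\Omega)\cap C(\overline\Omega)$, positive in $\Omega$ and zero at $a$ and $b$, such that $(K-\lambda M)u^{-\gamma}\in L^1_{loc}(\Omega)$ and $\int_\Omega u'\varphi'=\int_\Omega (K-\lambda M)u^{-\gamma}\varphi$ for all $\varphi\in C_c^\infty(\Omega)$. Let $P^\circ$ be the interior of the positive cone $\{w\ge 0\}$ of the Banach space $C^1_0(\overline\Omega)=\{w\in C^1(\overline\Omega): w(a)=w(b)=0\}$ with the $C^1$ norm. For $p\in[2,\infty]$ let $p'$ be given by $1/p+1/p'=1$ ($p'=1$ if $p=\infty$).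 (i) Let $p\in[2,\infty]$, $M\in L^p(\Omega)$ and $0<\gamma<1/p'$ (that is, $\gamma<(p-1)/p$ if $p<\infty$ and $\gamma<1$ if $p=\infty$), and suppose that $$\max\left(\|M_a\|_{L^p(\Omega)},\|M_b\|_{L^p(\Omega)}\right)\le c_{\gamma,p,a,b}\,\frac{\left(\int_a^b K\delta_\Omega\right)^{1+\gamma}}{\left(\int_a^b K\right)^{\gamma}},\qquad c_{\gamma,p,a,b}:=\frac{\gamma^\gamma}{(\gamma+1)^{\gamma+1}}\,\frac{(1-\gamma p')^{1/p'}}{(b-a)^{\gamma+1/p'}}.$$ Then there is $q\in(1,\infty)$ such that for every $\lambda\in(0,1]$ the problem $(P_{\gamma,\lambda})$ has a solution $u\in C^1(\Omega)\cap C(\overline\Omega)$, and this $u$ belongs to $W^{2,q}(\Omega)\cap P^\circ$ whenever $K\delta_\Omega^{-\gamma}\in L^r(\Omega)$ for some $r\in(1,\infty]$. (ii) If $$\max\left(\int_a^b M_a,\int_a^b M_b\right)<\int_a^b K\delta_\Omega,$$ then there are $\gamma_0>0$ and $q\in(1,\infty)$ such that for all $\gamma\in(0,\gamma_0]$ and all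 $\lambda\in(0,1]$ the problem $(P_{\gamma,\lambda})$ has a solution $u\in W^{2,q}(\Omega)\cap P^\circ$. -/

import Mathlib

open Set MeasureTheory
open scoped ENNReal

noncomputable section

/-- The distance to the boundary of the interval `Ω = (a, b)`. -/
def bdist (a b x : ℝ) : ℝ := Metric.infDist x (frontier (Ioo a b))

/-- The weighted function `h_a (x) = (x - a) h (x)`. -/
def leftWeighted (a : ℝ) (h : ℝ → ℝ) (x : ℝ) : ℝ := (x - a) * h x

/-- The weighted function `h_b (x) = (b - x) h (x)`. -/
def rightWeighted (b : ℝ) (h : ℝ → ℝ) (x : ℝ) : ℝ := (b - x) * h x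

/-- Lebesgue measure on the interval `(a, b)`. -/
def intervalMeasure (a b : ℝ) : Measure ℝ := volume.restrict (Ioo a b)

/-- The norm of `h` in `L^p (a, b)`, as a real number. -/
def lebesgueNorm (a b : ℝ) (p : ℝ≥0∞) (h : ℝ → ℝ) : ℝ :=
  (eLpNorm h p (intervalMeasure a b)).toReal

/-- The conjugate exponent `p'`, given by `1 / p + 1 / p' = 1`, with `p' = 1` if `p = ∞`. -/
def conjExp (p : ℝ≥0∞) : ℝ := (ENNReal.conjExponent p).toReal

/-- The constant `c_{γ, p, a, b}`. -/
def smallnessConst (γ : ℝ) (p : ℝ≥0∞) (a b : ℝ) : ℝ :=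
  γ ^ γ / (γ + 1) ^ (γ + 1) *
    ((1 - γ * conjExp p) ^ (1 / conjExp p) / (b - a) ^ (γ + 1 / conjExp p))

/-- `φ` is a smooth function with compact support contained in the open interval `(a, b)`. -/
structure IsTestFunction (a b : ℝ) (φ : ℝ → ℝ) : Prop where
  smooth : ContDiff ℝ (⊤ : ℕ∞) φ
  compactSupport : HasCompactSupport φ
  support_subset : tsupport φ ⊆ Ioo a b

/-- `u` is a solution, in the sense of distributions, of
`-u'' = K u ^ (-α) - lam * M u ^ (-γ)` in `(a, b)`, `u > 0` in `(a, b)`, `u (a) = u (b) = 0`,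
that belongs to `C¹ (Ω) ∩ C (closure Ω)`. -/
structure IsSolution (a b α γ lam : ℝ) (K M u : ℝ → ℝ) : Prop where
  contDiffOn : ContDiffOn ℝ 1 u (Ioo a b)
  continuousOn : ContinuousOn u (Icc a b)
  pos : ∀ x ∈ Ioo a b, 0 < u x
  left_eq_zero : u a = 0
  right_eq_zero : u b = 0
  locallyIntegrable :
    LocallyIntegrableOn (fun x => K x * u x ^ (-α) - lam * M x * u x ^ (-γ)) (Ioo a b)
  weak_eq : ∀ φ : ℝ → ℝ, IsTestFunction a b φ →
    ∫ x in Ioo a b, deriv u x * deriv φ x =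
      ∫ x in Ioo a b, (K x * u x ^ (-α) - lam * M x * u x ^ (-γ)) * φ x

/-- `g` is the weak (distributional) derivative of `f` in `(a, b)`. -/
structure HasWeakDeriv (a b : ℝ) (f g : ℝ → ℝ) : Prop where
  locallyIntegrable : LocallyIntegrableOn f (Ioo a b)
  locallyIntegrable_deriv : LocallyIntegrableOn g (Ioo a b)
  integral_eq : ∀ φ : ℝ → ℝ, IsTestFunction a b φ →
    ∫ x in Ioo a b, f x * deriv φ x = -∫ x in Ioo a b, g x * φ x

/-- Membership in the Sobolev space `W^{2,q} (a, b)`. -/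
def MemW2 (a b : ℝ) (q : ℝ≥0∞) (u : ℝ → ℝ) : Prop :=
  ∃ g h : ℝ → ℝ, HasWeakDeriv a b u g ∧ HasWeakDeriv a b g h ∧
    MemLp u q (intervalMeasure a b) ∧ MemLp g q (intervalMeasure a b) ∧
    MemLp h q (intervalMeasure a b)

/-- The normed space `C¹₀ ([a, b])` of the `C¹` functions on `[a, b]` that vanish at `a` and `b`.
An element is stored as the pair `(u, u')` of continuous functions on `[a, b]` (with one-sided
derivatives at the end points), so that the norm is `max (sup |u|) (sup |u'|)`. -/
def C1Zero (a b : ℝ) : Submodule ℝ (C(Icc a b, ℝ) × C(Icc a b, ℝ)) where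
  carrier := {z | (∀ x : Icc a b, HasDerivWithinAt
      (Function.extend (Subtype.val : Icc a b → ℝ) z.1 0) (z.2 x) (Icc a b) x) ∧
    ∀ x : Icc a b, (x : ℝ) = a ∨ (x : ℝ) = b → z.1 x = 0}
  add_mem' := by
    rintro z w ⟨hz, hz0⟩ ⟨hw, hw0⟩
    refine ⟨fun x => ?_, fun x hx => ?_⟩
    · have h := (hz x).add (hw x)
      rw [← Function.extend_add] at h
      simpa using h
    · simp [hz0 x hx, hw0 x hx]
  zero_mem' := by
    refine ⟨fun x => ?_, fun x _ => rfl⟩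
    have h : Function.extend (Subtype.val : Icc a b → ℝ)
        ((0 : C(Icc a b, ℝ) × C(Icc a b, ℝ)).1) 0 = 0 := by
      simpa using Function.extend_zero (Subtype.val : Icc a b → ℝ) (γ := ℝ)
    rw [h]
    exact hasDerivWithinAt_const _ _ _
  smul_mem' := by
    rintro c z ⟨hz, hz0⟩
    refine ⟨fun x => ?_, fun x hx => ?_⟩
    · have h := (hz x).const_smul c
      have e : Function.extend (Subtype.val : Icc a b → ℝ) ((c • z).1) 0 =
          c • Function.extend (Subtype.val : Icc a b → ℝ) z.1 0 := by
        simpa using Function.extend_smul c (Subtype.val : Icc a b → ℝ) z.1 0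
      rw [e]
      exact h
    · simp [hz0 x hx]

/-- The positive cone of `C¹₀ ([a, b])`: the functions that are nonnegative on `[a, b]`. -/
def positiveCone (a b : ℝ) : Set (C1Zero a b) := {z | ∀ x : Icc a b, 0 ≤ z.1.1 x}

/-- `u`, restricted to `[a, b]`, lies in `P°`, the interior of the positive cone of
`C¹₀ ([a, b])`. -/
def MemInteriorCone (a b : ℝ) (u : ℝ → ℝ) : Prop :=
  ∃ z ∈ interior (positiveCone a b), ∀ x : Icc a b, z.1.1 x = u x

end

open Filter Topology

/-! Write δ for the distance to the boundary, G for the Green function, L = b - a, I = ∫K and J =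
∫Kδ. Everything rests on one criterion, `exists_isSolution`: constants c, D, N > 0 chosen
independently of λ in (0,1] trap a solution between cδ and D.

The equation is first regularized to -u'' = K ψ(u) - λ M ψ(max(u, cδ)), with ψ(s) = ((s⁺)² +
ε²)^(-γ/2). Its right side is bounded and Lipschitz in u with integrable constants, so shooting
solves it (`exists_eq_potential`). Upper bound: for w = 1/ψ, the primitive W of w satisfies
-(W(u))'' ≤ K, because the term w'(u)u'² has a good sign. Hence W(u) ≤ ∫GK ≤ (L/4) I, which gives u
≤ D if (1+γ)(L/4) I ≤ D^(1+γ) (`primitive_comp_potential_le`). Lower bound: now ψ(u) ≥ (D+ε)^(-γ),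
while the truncation forces ψ(max(u, cδ)) ≤ (cδ)^(-γ). Since G(x,t) ≥ δ(x)δ(t)/L, and G(x,t) is at
most both (x-a)(b-t)/L and (b-x)(t-a)/L, one gets u ≥ (δ/L)((D+ε)^(-γ) J - N), where N dominates the
integrals of M_a(cδ)^(-γ) and M_b(cδ)^(-γ). This is at least cδ once cL + N ≤ (D+ε)^(-γ) J, so the
truncation is inactive. As ε → 0, Arzelà-Ascoli and dominated convergence give u = ∫G(K - λM)u^(-γ)
with u ≥ cδ. Regularity follows from u^(-γ) ≤ (cδ)^(-γ), and membership in P° from |w| ≤ ‖w‖δ on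
C¹₀.

For (i), Hölder gives N = c^(-γ) X ‖δ^(-γ)‖_{p'}, where X is the assumed bound on M_a and M_b. With
D^(1+γ) = LI/2 and the c that maximizes c^γ(D^(-γ)J - cL), the condition cL + N ≤ D^(-γ)J holds with
equality: this is where c_{γ,p,a,b} comes from (`smallness_identity`). For (ii), c and D are fixed
and γ → 0, so that the criterion tends to cL + max(∫M_a, ∫M_b) < J. -/

/-- The Green function of `-u''` on `(a, b)` with Dirichlet boundary conditions. -/
noncomputable def green (a b x t : ℝ) : ℝ := (x - a) * (b - t) / (b - a) - max (x - t) 0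

/-- The derivative of the Green function in its first variable. -/
noncomputable def greenDeriv (a b x t : ℝ) : ℝ := (b - t) / (b - a) - if t < x then 1 else 0

/-! ### Pointwise bounds on the Green function -/

section Green

variable {a b x y t : ℝ}

theorem green_of_le (h : x ≤ t) : green a b x t = (x - a) * (b - t) / (b - a) := by
  simp [green, h]

theorem green_of_ge (hab : a < b) (h : t ≤ x) : green a b x t = (t - a) * (b - x) / (b - a) := by
  have : b - a ≠ 0 := by linarith
  rw [green, max_eq_left (by linarith)]
  field_simp
  ring

theorem green_nonneg (hab : a < b) (hx : x ∈ Icc a b) (ht : t ∈ Icc a b) : 0 ≤ green a b x t := by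
  have h1 := sub_nonneg.2 hx.1
  have h2 := sub_nonneg.2 hx.2
  have h3 := sub_nonneg.2 ht.1
  have h4 := sub_nonneg.2 ht.2
  have h5 := (sub_pos.2 hab).le
  rcases le_total x t with h | h
  · rw [green_of_le h]; positivity
  · rw [green_of_ge hab h]; positivity

theorem green_le_weight (hab : a < b) (hx : x ∈ Icc a b) (ht : t ∈ Icc a b) :
    green a b x t ≤ (t - a) * (b - t) / (b - a) := by
  have h1 := sub_nonneg.2 hx.1
  have h3 := sub_nonneg.2 ht.1
  have h4 := sub_nonneg.2 ht.2
  have h5 := sub_pos.2 hab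
  rcases le_total x t with h | h
  · rw [green_of_le h]; gcongr
  · rw [green_of_ge hab h]; gcongr

theorem green_le_diag (hab : a < b) (hx : x ∈ Icc a b) :
    green a b x t ≤ (x - a) * (b - x) / (b - a) := by
  have h1 := sub_nonneg.2 hx.1
  have h2 := sub_nonneg.2 hx.2
  have h5 := sub_pos.2 hab
  rcases le_total x t with h | h
  · rw [green_of_le h]; gcongr
  · rw [green_of_ge hab h]; gcongr

theorem green_le_quarter (hab : a < b) (hx : x ∈ Icc a b) :
    green a b x t ≤ (b - a) / 4 := by
  refine (green_le_diag hab hx).trans ?_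
  rw [div_le_iff₀ (sub_pos.2 hab)]
  nlinarith [sq_nonneg ((x - a) - (b - x))]

theorem green_le_left (hab : a < b) (hx : x ∈ Icc a b) :
    green a b x t ≤ (x - a) * (b - t) / (b - a) := by
  have h5 := sub_pos.2 hab
  rcases le_total x t with h | h
  · rw [green_of_le h]
  · rw [green_of_ge hab h]
    have h4 := sub_nonneg.2 hx.2
    have h3 := sub_nonneg.2 hx.1
    gcongr

theorem green_le_right (hab : a < b) (ht : t ∈ Icc a b) :
    green a b x t ≤ (b - x) * (t - a) / (b - a) := by
  have h5 := sub_pos.2 hab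
  rcases le_total x t with h | h
  · rw [green_of_le h, mul_comm (b - x)]
    have h4 := sub_nonneg.2 ht.2
    have h3 := sub_nonneg.2 ht.1
    gcongr
  · rw [green_of_ge hab h, mul_comm]

/-- Each of the two explicit branches is a product of one-sided distances, and each factor is at
least the minimum. This product form carries the lower bound of the solution by a multiple of the
distance. -/
theorem le_green (hab : a < b) (hx : x ∈ Icc a b) (ht : t ∈ Icc a b) :
    min (x - a) (b - x) * min (t - a) (b - t) / (b - a) ≤ green a b x t := by
  have h1 := sub_nonneg.2 hx.1
  have h2 := sub_nonneg.2 hx.2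
  have h3 := sub_nonneg.2 ht.1
  have h4 := sub_nonneg.2 ht.2
  have h5 := sub_pos.2 hab
  rcases le_total x t with h | h
  · rw [green_of_le h]
    gcongr
    · exact min_le_left _ _
    · exact min_le_right _ _
  · rw [green_of_ge hab h, mul_comm (t - a)]
    gcongr
    · exact min_le_right _ _
    · exact min_le_left _ _

theorem green_left (ht : t ∈ Icc a b) : green a b a t = 0 := by
  rw [green_of_le ht.1]; simp

theorem green_right (hab : a < b) (ht : t ∈ Icc a b) : green a b b t = 0 := by
  rw [green_of_ge hab ht.2]; simp

theorem continuous_green : Continuous fun z : ℝ × ℝ => green a b z.1 z.2 := by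
  unfold green; fun_prop

theorem measurable_greenDeriv : Measurable (greenDeriv a b x) := by
  unfold greenDeriv
  refine Measurable.sub (by fun_prop) ?_
  exact Measurable.ite measurableSet_Iio measurable_const measurable_const

theorem hasDerivAt_green (hxt : x ≠ t) :
    HasDerivAt (fun z => green a b z t) (greenDeriv a b x t) x := by
  have h1 : HasDerivAt (fun z => (z - a) * (b - t) / (b - a)) ((b - t) / (b - a)) x := by
    simpa using (((hasDerivAt_id x).sub_const a).mul_const (b - t)).div_const (b - a)
  refine h1.sub ?_
  rcases lt_or_gt_of_ne hxt with h | h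
  · rw [if_neg (not_lt.2 h.le)]
    refine (hasDerivAt_const x (0 : ℝ)).congr_of_eventuallyEq ?_
    filter_upwards [eventually_lt_nhds h] with z hz
    exact max_eq_right (by linarith)
  · rw [if_pos h]
    refine ((hasDerivAt_id x).sub_const t).congr_of_eventuallyEq ?_
    filter_upwards [eventually_gt_nhds h] with z hz
    exact max_eq_left (by simp; linarith)

theorem abs_green_sub_le (hab : a < b) (ht : t ∈ Icc a b) :
    |green a b x t - green a b y t| ≤ 2 * |x - y| := by
  have h5 := sub_pos.2 hab
  have e : green a b x t - green a b y t =
      (x - y) * ((b - t) / (b - a)) - (max (x - t) 0 - max (y - t) 0) := by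
    unfold green; ring
  have h1 : 0 ≤ (b - t) / (b - a) := div_nonneg (sub_nonneg.2 ht.2) h5.le
  have h2 : (b - t) / (b - a) ≤ 1 := by rw [div_le_one h5]; linarith [ht.1]
  rw [e]
  refine (abs_sub _ _).trans ?_
  have h3 : |max (x - t) 0 - max (y - t) 0| ≤ |x - y| := by
    simpa using abs_max_sub_max_le_abs (x - t) (y - t) 0
  rw [abs_mul, abs_of_nonneg h1]
  nlinarith [abs_nonneg (x - y)]

/-- For t outside [c, d] the kernel is linear in x on [c, d], with a slope that vanishes as t tends
to the nearer end of (a, b); for t inside, the weight is bounded below. The weight allows sources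
that are not integrable up to the boundary. -/
theorem abs_green_sub_le_weight {c d : ℝ} (hac : a < c) (hcd : c < d) (hdb : d < b)
    (hx : x ∈ Icc c d) (hy : y ∈ Icc c d) (ht : t ∈ Icc a b) :
    |green a b x t - green a b y t| ≤
      2 / ((c - a) * (b - d)) * ((t - a) * (b - t)) * |x - y| := by
  have hab : a < b := by linarith
  have h1 := sub_pos.2 hac
  have h2 := sub_pos.2 hdb
  have h3 := sub_nonneg.2 ht.1
  have h4 := sub_nonneg.2 ht.2
  have h5 := sub_pos.2 hab
  have hC : 1 / (b - a) ≤ 2 / (c - a) := by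
    rw [div_le_div_iff₀ h5 h1]; linarith
  have hD : 1 / (b - a) ≤ 2 / (b - d) := by
    rw [div_le_div_iff₀ h5 h2]; linarith
  rcases lt_or_ge t c with h | h
  · rw [green_of_ge hab (h.le.trans hx.1), green_of_ge hab (h.le.trans hy.1)]
    have e : (t - a) * (b - x) / (b - a) - (t - a) * (b - y) / (b - a) =
      (1 / (b - a) * (t - a)) * (y - x) := by ring
    rw [e, abs_mul, abs_sub_comm y x]
    gcongr
    rw [abs_of_nonneg (by positivity)]
    calc 1 / (b - a) * (t - a) ≤ 2 / (c - a) * (t - a) := by gcongr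
      _ = 2 / ((c - a) * (b - d)) * ((t - a) * (b - d)) := by field_simp
      _ ≤ _ := by gcongr; linarith
  rcases lt_or_ge d t with h' | h'
  · rw [green_of_le (hx.2.trans h'.le), green_of_le (hy.2.trans h'.le)]
    have e : (x - a) * (b - t) / (b - a) - (y - a) * (b - t) / (b - a) =
      (1 / (b - a) * (b - t)) * (x - y) := by ring
    rw [e, abs_mul]
    gcongr
    rw [abs_of_nonneg (by positivity)]
    calc 1 / (b - a) * (b - t) ≤ 2 / (b - d) * (b - t) := by gcongr
      _ = 2 / ((c - a) * (b - d)) * ((c - a) * (b - t)) := by field_simp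
      _ ≤ _ := by gcongr
  · refine (abs_green_sub_le hab ht).trans ?_
    gcongr
    calc (2 : ℝ) = 2 / ((c - a) * (b - d)) * ((c - a) * (b - d)) := by field_simp
      _ ≤ _ := by gcongr

end Green

/-! ### Green potentials and their derivatives -/

theorem ae_mem_Ioo (a b : ℝ) : ∀ᵐ t ∂(intervalMeasure a b), t ∈ Ioo a b :=
  ae_restrict_mem measurableSet_Ioo

instance isFiniteMeasure_intervalMeasure (a b : ℝ) : IsFiniteMeasure (intervalMeasure a b) := by
  unfold intervalMeasure; infer_instance

instance nullSingletonClass_intervalMeasure (a b : ℝ) :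
    NullSingletonClass (intervalMeasure a b) := by
  unfold intervalMeasure; infer_instance

section Potential

variable {a b : ℝ} {h : ℝ → ℝ}

theorem integrable_weight_of_integrable (hh : Integrable h (intervalMeasure a b)) :
    Integrable (fun t => (t - a) * (b - t) * h t) (intervalMeasure a b) := by
  rcases le_or_gt b a with hab | hab
  · have : intervalMeasure a b = 0 := by simp [intervalMeasure, Ioo_eq_empty hab.not_gt]
    simp [this]
  refine hh.bdd_mul (c := (b - a) * (b - a)) (by fun_prop) ?_
  filter_upwards [ae_mem_Ioo a b] with t ht
  rw [Real.norm_eq_abs, abs_of_nonneg (mul_nonneg (by linarith [ht.1]) (by linarith [ht.2]))]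
  gcongr <;> linarith [ht.1, ht.2]

theorem integrable_green_mul (hab : a < b) (hm : AEStronglyMeasurable h (intervalMeasure a b))
    (hh : Integrable (fun t => (t - a) * (b - t) * h t) (intervalMeasure a b))
    {x : ℝ} (hx : x ∈ Icc a b) :
    Integrable (fun t => green a b x t * h t) (intervalMeasure a b) := by
  refine (hh.div_const (b - a)).mono
    ((continuous_green.comp (Continuous.prodMk_right x)).aestronglyMeasurable.mul hm) ?_
  filter_upwards [ae_mem_Ioo a b] with t ht
  have ht' := Ioo_subset_Icc_self ht
  have e : (t - a) * (b - t) * h t / (b - a) = (t - a) * (b - t) / (b - a) * h t := by ring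
  rw [e, norm_mul, norm_mul, Real.norm_of_nonneg (green_nonneg hab hx ht')]
  gcongr
  exact (green_le_weight hab hx ht').trans (le_abs_self _)

/-- The solution of `-u'' = h`, `u (a) = u (b) = 0`. -/
noncomputable def potential (a b : ℝ) (h : ℝ → ℝ) (x : ℝ) : ℝ :=
  ∫ t, green a b x t * h t ∂(intervalMeasure a b)

/-- The derivative of `potential a b h`. -/
noncomputable def potentialDeriv (a b : ℝ) (h : ℝ → ℝ) (x : ℝ) : ℝ :=
  ∫ t, greenDeriv a b x t * h t ∂(intervalMeasure a b)

theorem potential_left : potential a b h a = 0 := by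
  refine integral_eq_zero_of_ae ?_
  filter_upwards [ae_mem_Ioo a b] with t ht
  simp [green_left (Ioo_subset_Icc_self ht)]

theorem potential_right (hab : a < b) : potential a b h b = 0 := by
  refine integral_eq_zero_of_ae ?_
  filter_upwards [ae_mem_Ioo a b] with t ht
  simp [green_right hab (Ioo_subset_Icc_self ht)]

/-- Differentiation under the integral sign; the kink of the kernel at t = x is a null set. The free
Lipschitz weight `L` serves both integrable sources and sources with only a weighted integral. -/
theorem hasDerivAt_potential_of_lipschitz {x : ℝ} {s : Set ℝ} (hs : s ∈ 𝓝 x) {L : ℝ → ℝ}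
    (hm : AEStronglyMeasurable h (intervalMeasure a b))
    (hL : ∀ t ∈ Ioo a b, ∀ y ∈ s, ∀ z ∈ s, |green a b y t - green a b z t| ≤ L t * |y - z|)
    (hLh : Integrable (fun t => L t * h t) (intervalMeasure a b))
    (hint : Integrable (fun t => green a b x t * h t) (intervalMeasure a b)) :
    Integrable (fun t => greenDeriv a b x t * h t) (intervalMeasure a b) ∧
      HasDerivAt (potential a b h) (potentialDeriv a b h x) x := by
  refine hasDerivAt_integral_of_dominated_loc_of_lip (bound := fun t => L t * h t) hs
    (Eventually.of_forall fun y => ?_) hint ?_ ?_ hLh ?_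
  · exact (continuous_green.comp (Continuous.prodMk_right y)).aestronglyMeasurable.mul hm
  · exact measurable_greenDeriv.aestronglyMeasurable.mul hm
  · filter_upwards [ae_mem_Ioo a b] with t ht
    refine LipschitzOnWith.of_dist_le_mul fun y hy z hz => ?_
    rw [Real.dist_eq, Real.dist_eq, ← sub_mul, abs_mul, Real.coe_nnabs, abs_mul]
    have h1 := hL t ht y hy z hz
    calc |green a b y t - green a b z t| * |h t| ≤ (L t * |y - z|) * |h t| := by gcongr
      _ ≤ (|L t| * |y - z|) * |h t| := by gcongr; exact le_abs_self _
      _ = _ := by ring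
  · have : ∀ᵐ t ∂(intervalMeasure a b), t ≠ x := by simp [ae_iff, measure_singleton]
    filter_upwards [this] with t ht
    exact (hasDerivAt_green ht.symm).mul_const _

theorem hasDerivAt_potential (hab : a < b) (hh : Integrable h (intervalMeasure a b)) (x : ℝ) :
    Integrable (fun t => greenDeriv a b x t * h t) (intervalMeasure a b) ∧
      HasDerivAt (potential a b h) (potentialDeriv a b h x) x := by
  refine hasDerivAt_potential_of_lipschitz (s := univ) (L := fun _ => 2) univ_mem hh.1
    (fun t ht y _ z _ => abs_green_sub_le hab (Ioo_subset_Icc_self ht)) (hh.const_mul 2) ?_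
  refine hh.bdd_mul (c := 2 * |x - a|)
    (continuous_green.comp (Continuous.prodMk_right x)).aestronglyMeasurable ?_
  filter_upwards [ae_mem_Ioo a b] with t ht
  have h1 := abs_green_sub_le (x := x) (y := a) hab (Ioo_subset_Icc_self ht)
  rwa [green_left (Ioo_subset_Icc_self ht), sub_zero] at h1

theorem hasDerivAt_potential_of_weight (hm : AEStronglyMeasurable h (intervalMeasure a b))
    (hh : Integrable (fun t => (t - a) * (b - t) * h t) (intervalMeasure a b))
    {x : ℝ} (hx : x ∈ Ioo a b) :
    Integrable (fun t => greenDeriv a b x t * h t) (intervalMeasure a b) ∧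
      HasDerivAt (potential a b h) (potentialDeriv a b h x) x := by
  obtain ⟨c, hac, hcx⟩ := exists_between hx.1
  obtain ⟨d, hxd, hdb⟩ := exists_between hx.2
  have hcd := hcx.trans hxd
  refine hasDerivAt_potential_of_lipschitz (s := Icc c d) (Icc_mem_nhds hcx hxd)
    (L := fun t => 2 / ((c - a) * (b - d)) * ((t - a) * (b - t))) hm
    (fun t ht y hy z hz => abs_green_sub_le_weight hac hcd hdb hy hz (Ioo_subset_Icc_self ht)) ?_
    (integrable_green_mul (hx.1.trans hx.2) hm hh (Ioo_subset_Icc_self hx))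
  simpa only [mul_assoc] using hh.const_mul (2 / ((c - a) * (b - d)))

theorem integral_intervalMeasure (hab : a ≤ b) (f : ℝ → ℝ) :
    ∫ t, f t ∂(intervalMeasure a b) = ∫ t in a..b, f t := by
  rw [intervalIntegral.integral_of_le hab, integral_Ioc_eq_integral_Ioo]; rfl

theorem potentialDeriv_sub {x y : ℝ} (hax : a ≤ x) (hxy : x ≤ y) (hyb : y ≤ b)
    (hx : Integrable (fun t => greenDeriv a b x t * h t) (intervalMeasure a b))
    (hy : Integrable (fun t => greenDeriv a b y t * h t) (intervalMeasure a b)) :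
    potentialDeriv a b h y = potentialDeriv a b h x - ∫ t in x..y, h t := by
  have key : potentialDeriv a b h x - potentialDeriv a b h y = ∫ t in x..y, h t := by
    unfold potentialDeriv
    rw [← integral_sub hx hy]
    -- The kernels differ only by the unit jump, which the strict inequality in `greenDeriv` puts on
    -- the half-open interval [x, y).
    have e : ∀ t, greenDeriv a b x t * h t - greenDeriv a b y t * h t =
        (Ico x y).indicator h t := by
      intro t
      by_cases h1 : t < x
      · simp [greenDeriv, h1, h1.trans_le hxy]
      · by_cases h2 : t < y
        · simp [greenDeriv, h1, h2, indicator, not_lt.1 h1]; ring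
        · simp [greenDeriv, h1, h2]
    simp_rw [e]
    rw [integral_indicator measurableSet_Ico,
      setIntegral_congr_set (Ioo_ae_eq_Ico (μ := intervalMeasure a b)).symm, intervalMeasure,
      Measure.restrict_restrict measurableSet_Ioo,
      inter_eq_left.2 (Ioo_subset_Ioo hax hyb), ← integral_Ioc_eq_integral_Ioo,
      intervalIntegral.integral_of_le hxy]
  linarith

end Potential

/-! ### Shooting for a bounded Lipschitz nonlinearity -/

section Shooting

variable {a b : ℝ}

theorem max_mul_exp_le {θ : ℝ} (hθ : 0 < θ) (s : ℝ) : max s 0 * Real.exp (-(θ * s)) ≤ 1 / θ := by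
  rcases le_total s 0 with hs | hs
  · rw [max_eq_right hs, zero_mul]; positivity
  · rw [max_eq_left hs, Real.exp_neg, ← div_eq_mul_inv, div_le_div_iff₀ (Real.exp_pos _) hθ]
    nlinarith [Real.add_one_le_exp (θ * s)]

/-- A nonlinear two-point boundary value problem `-u'' = f (t, u)`, `u (a) = u (b) = 0`, whose
right hand side is bounded and Lipschitz in `u` with integrable constants, has a solution. -/
theorem exists_eq_potential (hab : a < b) {f : ℝ → ℝ → ℝ} {k : ℝ → ℝ}
    (hk : Integrable k (intervalMeasure a b))
    (hfm : ∀ v : ℝ → ℝ, Continuous v →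
      AEStronglyMeasurable (fun t => f t (v t)) (intervalMeasure a b))
    (hfk : ∀ᵐ t ∂(intervalMeasure a b), ∀ s, |f t s| ≤ k t)
    (hfl : ∀ᵐ t ∂(intervalMeasure a b), ∀ s r, |f t s - f t r| ≤ k t * |s - r|) :
    ∃ u : ℝ → ℝ, Continuous u ∧
      ∀ x ∈ Icc a b, u x = potential a b (fun t => f t (u t)) x := by
  have h5 := sub_pos.2 hab
  set B : ℝ := ∫ t, k t ∂(intervalMeasure a b) with hB
  have hk0 : ∀ᵐ t ∂(intervalMeasure a b), 0 ≤ k t := by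
    filter_upwards [hfk] with t ht
    exact (abs_nonneg _).trans (ht 0)
  have hB0 : 0 ≤ B := integral_nonneg_of_ae hk0
  -- Rate of the exponential weight: it makes the Volterra operator contract with factor B/θ ≤ 1/2.
  -- The extra 1 keeps it positive if B = 0.
  set θ : ℝ := 2 * B + 1 with hθ
  have hθ0 : 0 < θ := by positivity
  -- The unknown is stored as v = e^(-θt)u, so that the sup norm of v is the weighted norm of u; `E`
  -- recovers u.
  let E : C(Icc a b, ℝ) → ℝ → ℝ := fun v t => Real.exp (θ * t) * IccExtend hab.le v t
  have hE : ∀ v, Continuous (E v) := fun v => by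
    have := v.continuous.Icc_extend' (h := hab.le)
    fun_prop
  have hfint : ∀ v, Integrable (fun t => f t (E v t)) (intervalMeasure a b) := fun v =>
    hk.mono' (hfm _ (hE v)) (hfk.mono fun t ht => ht _)
  have hmul : ∀ v, ∀ x ∈ Icc a b,
      Integrable (fun t => max (x - t) 0 * f t (E v t)) (intervalMeasure a b) := fun v x hx => by
    refine (hfint v).bdd_mul (c := b - a)
      (by fun_prop : Continuous fun t : ℝ => max (x - t) 0).aestronglyMeasurable ?_
    filter_upwards [ae_mem_Ioo a b] with t ht
    rw [Real.norm_of_nonneg (le_max_right _ _)]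
    exact max_le (by linarith [hx.2, ht.1]) h5.le
  let V : C(Icc a b, ℝ) → ℝ → ℝ := fun v x =>
    ∫ t, max (x - t) 0 * f t (E v t) ∂(intervalMeasure a b)
  have hV : ∀ v, Continuous fun x : Icc a b => V v x := fun v => by
    refine continuous_of_dominated (bound := fun t => (b - a) * k t)
      (fun x => (hmul v x x.2).1) (fun x => ?_) (hk.const_mul _) ?_
    · filter_upwards [ae_mem_Ioo a b, hfk] with t ht hft
      rw [norm_mul, Real.norm_of_nonneg (le_max_right _ _)]
      gcongr
      · exact max_le (by linarith [x.2.2, ht.1]) h5.le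
      · exact hft _
    · exact Eventually.of_forall fun t => by fun_prop
  have hVB : ∀ v, |V v b| ≤ (b - a) * B := fun v => by
    rw [hB, ← integral_const_mul, ← Real.norm_eq_abs]
    refine norm_integral_le_of_norm_le (hk.const_mul _) ?_
    filter_upwards [ae_mem_Ioo a b, hfk] with t ht hft
    rw [norm_mul, Real.norm_of_nonneg (le_max_right _ _)]
    gcongr
    · exact max_le (by linarith [ht.1]) h5.le
    · exact hft _
  -- A fixed point is a solution of the initial value problem u(a) = 0, u'(a) = m, in integrated
  -- form.
  let S : ℝ → C(Icc a b, ℝ) → C(Icc a b, ℝ) := fun m v =>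
    ⟨fun x => Real.exp (-(θ * x)) * (m * (x - a) - V v x), by
      exact Continuous.mul (by fun_prop) (Continuous.sub (by fun_prop) (hV v))⟩
  have hS : ∀ m, ContractingWith (1 / 2) (S m) := fun m => by
    refine ⟨by norm_num, LipschitzWith.of_dist_le_mul fun v w => ?_⟩
    rw [ContinuousMap.dist_le (by positivity)]
    intro x
    have e : S m v x - S m w x = ∫ t, Real.exp (-(θ * x)) *
        (max ((x : ℝ) - t) 0 * (f t (E w t) - f t (E v t))) ∂(intervalMeasure a b) := by
      have : S m v x - S m w x = Real.exp (-(θ * x)) * (V w x - V v x) := by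
        simp only [S, ContinuousMap.coe_mk]; ring
      rw [this, integral_const_mul, ← integral_sub (hmul w x x.2) (hmul v x x.2)]
      simp only [mul_sub]
    rw [Real.dist_eq, e, ← Real.norm_eq_abs]
    calc _ ≤ ∫ t, (1 / θ * dist v w) * k t ∂(intervalMeasure a b) := by
          refine norm_integral_le_of_norm_le (hk.const_mul _) ?_
          filter_upwards [ae_mem_Ioo a b, hfl, hk0] with t ht hft hkt
          rw [norm_mul, norm_mul, Real.norm_of_nonneg (le_max_right _ _),
            Real.norm_of_nonneg (Real.exp_pos _).le, Real.norm_eq_abs]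
          have h1 := hft (E w t) (E v t)
          have h2 : |E w t - E v t| ≤ Real.exp (θ * t) * dist v w := by
            rw [← mul_sub, abs_mul, abs_of_pos (Real.exp_pos _), ← Real.dist_eq, dist_comm v w]
            gcongr
            exact ContinuousMap.dist_apply_le_dist _
          have h3 := max_mul_exp_le hθ0 ((x : ℝ) - t)
          have h4 : Real.exp (-(θ * ((x : ℝ) - t))) =
              Real.exp (-(θ * x)) * Real.exp (θ * t) := by rw [← Real.exp_add]; ring_nf
          have h6 : 0 ≤ max ((x : ℝ) - t) 0 := le_max_right _ _
          calc _ ≤ Real.exp (-(θ * x)) *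
                (max ((x : ℝ) - t) 0 * (k t * (Real.exp (θ * t) * dist v w))) := by
                gcongr
                exact h1.trans (by gcongr)
            _ = (max ((x : ℝ) - t) 0 * Real.exp (-(θ * ((x : ℝ) - t)))) * dist v w * k t := by
                rw [h4]; ring
            _ ≤ _ := by gcongr
      _ = (B / θ) * dist v w := by rw [integral_const_mul]; ring
      _ ≤ _ := by
          gcongr
          push_cast
          rw [div_le_div_iff₀ hθ0 (by norm_num)]
          linarith
  let p : ℝ → C(Icc a b, ℝ) := fun m => (hS m).fixedPoint
  have hp : ∀ m, S m (p m) = p m := fun m => (hS m).fixedPoint_isFixedPt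
  have hpc : Continuous p := by
    refine (LipschitzWith.of_dist_le' (K := Real.exp (-(θ * a)) * (b - a) * 2)
      fun m m' => ?_).continuous
    have h1 : ∀ z, dist (S m z) (S m' z) ≤ Real.exp (-(θ * a)) * (b - a) * dist m m' := fun z => by
      rw [ContinuousMap.dist_le (by positivity)]
      intro x
      have e : S m z x - S m' z x = Real.exp (-(θ * x)) * (x - a) * (m - m') := by
        simp only [S, ContinuousMap.coe_mk]; ring
      have h2 := sub_nonneg.2 x.2.1
      have h3 := x.2.1
      rw [Real.dist_eq, e, abs_mul, abs_of_nonneg (by positivity), Real.dist_eq]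
      gcongr
      exact x.2.2
    refine ((hS m).fixedPoint_lipschitz_in_map (hS m') h1).trans (le_of_eq ?_)
    push_cast
    ring
  let e : Icc a b := ⟨b, right_mem_Icc.2 hab.le⟩
  have hpe : ∀ m, p m e = Real.exp (-(θ * b)) * (m * (b - a) - V (p m) b) := fun m => by
    conv_lhs => rw [← hp m]
    rfl
  -- Since |V(b)| ≤ (b - a)B, the slopes -B and B leave the end value on opposite sides of 0.
  have hmem : (0 : ℝ) ∈ Icc (p (-B) e) (p B e) := by
    constructor
    · rw [hpe]
      have := (abs_le.1 (hVB (p (-B)))).1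
      exact mul_nonpos_of_nonneg_of_nonpos (Real.exp_pos _).le (by linarith)
    · rw [hpe]
      have := (abs_le.1 (hVB (p B))).2
      exact mul_nonneg (Real.exp_pos _).le (by linarith)
  obtain ⟨m, -, hm⟩ := intermediate_value_Icc (f := fun m => p m e) (by linarith : -B ≤ B)
    (by fun_prop) hmem
  have hu : ∀ x ∈ Icc a b, E (p m) x = m * (x - a) - V (p m) x := fun x hx => by
    have h1 : p m ⟨x, hx⟩ = Real.exp (-(θ * x)) * (m * (x - a) - V (p m) x) := by
      conv_lhs => rw [← hp m]
      rfl
    simp only [E]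
    rw [IccExtend_of_mem _ _ hx, h1, ← mul_assoc, ← Real.exp_add]
    simp
  refine ⟨E (p m), hE _, fun x hx => ?_⟩
  have hb0 : m * (b - a) = V (p m) b := by
    simp only [hpe] at hm
    have := (mul_eq_zero.1 hm).resolve_left (Real.exp_pos _).ne'
    linarith
  -- Eliminating the slope through u(b) = 0 turns the Volterra kernel into the Green function.
  have hmV : m = V (p m) b / (b - a) := by rw [← hb0]; field_simp
  have e1 : V (p m) b / (b - a) * (x - a) = ∫ t, (x - a) / (b - a) *
      (max (b - t) 0 * f t (E (p m) t)) ∂(intervalMeasure a b) := by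
    rw [integral_const_mul]; ring
  rw [hu x hx]
  have e2 : m * (x - a) = V (p m) b / (b - a) * (x - a) := by rw [← hmV]
  rw [e2, e1]
  simp only [V, potential]
  rw [← integral_sub ((hmul _ _ (right_mem_Icc.2 hab.le)).const_mul _) (hmul _ _ hx)]
  refine integral_congr_ae ?_
  filter_upwards [ae_mem_Ioo a b] with t ht
  rw [green, max_eq_left (by linarith [ht.2] : 0 ≤ b - t)]
  ring

end Shooting

/-! ### Integration by parts and the upper bound -/

theorem integrable_intervalMeasure_iff {a b : ℝ} (hab : a ≤ b) {f : ℝ → ℝ} :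
    Integrable f (intervalMeasure a b) ↔ IntervalIntegrable f volume a b :=
  (intervalIntegrable_iff_integrableOn_Ioo_of_le hab).symm

/-- Integration by parts of a `C¹` function against a primitive of an integrable function. -/
theorem integral_mul_eq_of_primitive {x y : ℝ} (hxy : x ≤ y) {φ φ' g h : ℝ → ℝ}
    (hh : IntervalIntegrable h volume x y)
    (hg : ∀ t ∈ Icc x y, g t = g x - ∫ s in x..t, h s)
    (hφ : ∀ t ∈ Icc x y, HasDerivAt φ (φ' t) t) (hφ' : ContinuousOn φ' (Icc x y)) :
    ∫ t in x..y, φ t * h t = φ x * g x - φ y * g y + ∫ t in x..y, φ' t * g t := by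
  have hu : uIcc x y = Icc x y := uIcc_of_le hxy
  obtain ⟨C, hC⟩ := isCompact_Icc.exists_bound_of_continuousOn hφ'
  have hφL : LipschitzOnWith C.toNNReal φ (Icc x y) :=
    (convex_Icc x y).lipschitzOnWith_of_nnnorm_hasDerivWithin_le
      (fun t ht => (hφ t ht).hasDerivWithinAt) fun t ht => by
        rw [← NNReal.coe_le_coe, coe_nnnorm]
        exact (hC t ht).trans (Real.le_coe_toNNReal C)
  -- As h is only integrable, its primitive is differentiable only almost everywhere, and
  -- integration by parts is done for absolutely continuous functions.
  have hφac : AbsolutelyContinuousOnInterval φ x y :=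
    LipschitzOnWith.absolutelyContinuousOnInterval (by rwa [hu])
  have hFac := hh.absolutelyContinuousOnInterval_intervalIntegral (c := x) (by simp)
  have key := hφac.integral_mul_deriv_eq_deriv_mul hFac
  have e1 : ∫ t in x..y, φ t * deriv (fun z => ∫ s in x..z, h s) t = ∫ t in x..y, φ t * h t := by
    refine intervalIntegral.integral_congr_ae ?_
    filter_upwards [hh.ae_hasDerivAt_integral] with t ht htm
    rw [(ht (uIoc_subset_uIcc htm) x (by simp)).deriv]
  have hgc : ContinuousOn g (Icc x y) :=
    (continuousOn_const.sub (hu ▸ hFac.continuousOn)).congr hg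
  have e2 : ∫ t in x..y, deriv φ t * ∫ s in x..t, h s =
      ∫ t in x..y, (φ' t * g x - φ' t * g t) := by
    refine intervalIntegral.integral_congr fun t ht => ?_
    rw [hu] at ht
    simp only [(hφ t ht).deriv, hg t ht]
    ring
  have i1 : IntervalIntegrable φ' volume x y := (hu ▸ hφ').intervalIntegrable
  have i2 : IntervalIntegrable (fun t => φ' t * g t) volume x y :=
    (hu ▸ hφ'.mul hgc : ContinuousOn _ (uIcc x y)).intervalIntegrable
  rw [e1, e2, intervalIntegral.integral_sub (i1.mul_const _) i2,
    intervalIntegral.integral_mul_const, intervalIntegral.integral_eq_sub_of_hasDerivAt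
      (fun t ht => hφ t (hu ▸ ht)) i1] at key
  rw [key, hg y (right_mem_Icc.2 hxy)]
  simp
  ring

section APriori

variable {a b : ℝ} {h : ℝ → ℝ}

theorem potentialDeriv_eq_sub (hab : a < b) (hh : Integrable h (intervalMeasure a b)) {x y : ℝ}
    (hax : a ≤ x) (hxy : x ≤ y) (hyb : y ≤ b) :
    potentialDeriv a b h y = potentialDeriv a b h x - ∫ t in x..y, h t :=
  potentialDeriv_sub hax hxy hyb (hasDerivAt_potential hab hh x).1 (hasDerivAt_potential hab hh y).1

theorem continuousOn_potentialDeriv (hab : a < b) (hh : Integrable h (intervalMeasure a b)) :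
    ContinuousOn (potentialDeriv a b h) (Icc a b) := by
  have h1 := ((integrable_intervalMeasure_iff hab.le).1
    hh).absolutelyContinuousOnInterval_intervalIntegral (c := a) (by simp)
  have h2 := h1.continuousOn
  rw [uIcc_of_le hab.le] at h2
  exact (continuousOn_const.sub h2).congr fun y hy =>
    potentialDeriv_eq_sub hab hh le_rfl hy.1 hy.2

/-- If `-u'' = h` with `h * w u ≤ K`, where `w` is positive and nondecreasing, then the primitive
of `w` at `u` is at most the solution of the linear problem with right hand side `K`. -/
theorem primitive_comp_potential_le (hab : a < b) {K w w' : ℝ → ℝ}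
    (hh : Integrable h (intervalMeasure a b)) (hK : Integrable K (intervalMeasure a b))
    (hw : ∀ s, HasDerivAt w (w' s) s) (hw'c : Continuous w') (hw' : ∀ s, 0 ≤ w' s)
    (hle : ∀ᵐ t ∂(intervalMeasure a b), h t * w (potential a b h t) ≤ K t)
    {x : ℝ} (hx : x ∈ Icc a b) :
    ∫ s in (0 : ℝ)..potential a b h x, w s ≤ potential a b K x := by
  set U := potential a b h with hU
  set g := potentialDeriv a b h with hg
  have hUd : ∀ x, HasDerivAt U (g x) x := fun x => (hasDerivAt_potential hab hh x).2
  have hUc : Continuous U := continuous_iff_continuousAt.2 fun x => (hUd x).continuousAt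
  have hwc : Continuous w := continuous_iff_continuousAt.2 fun x => (hw x).continuousAt
  have hgc : ContinuousOn g (Icc a b) := continuousOn_potentialDeriv hab hh
  have hWd : ∀ x, HasDerivAt (fun x => (∫ s in (0 : ℝ)..U x, w s) - potential a b K x)
      (w (U x) * g x - potentialDeriv a b K x) x := fun x =>
    ((intervalIntegral.integral_hasDerivAt_right (hwc.intervalIntegrable _ _)
      (hwc.stronglyMeasurableAtFilter _ _) hwc.continuousAt).comp x (hUd x)).sub
      (hasDerivAt_potential hab hK x).2
  -- The increment of w(U)U' - (∫GK)' over [x, y] is ∫(K - h w(U)) + ∫w'(U)U'², and both integrals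
  -- are nonnegative; no pointwise second derivative is needed.
  have hmono : MonotoneOn (fun x => w (U x) * g x - potentialDeriv a b K x) (Icc a b) := by
    intro x hx y hy hxy
    have hsub : Icc x y ⊆ Icc a b := Icc_subset_Icc hx.1 hy.2
    have hsubu : uIcc x y ⊆ uIcc a b := by rwa [uIcc_of_le hxy, uIcc_of_le hab.le]
    have ih := ((integrable_intervalMeasure_iff hab.le).1 hh).mono_set hsubu
    have iK := ((integrable_intervalMeasure_iff hab.le).1 hK).mono_set hsubu
    have hp := integral_mul_eq_of_primitive (φ := fun t => w (U t))
      (φ' := fun t => w' (U t) * g t) (g := g) hxy ih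
      (fun t ht => potentialDeriv_eq_sub hab hh hx.1 ht.1 (ht.2.trans hy.2))
      (fun t _ => (hw _).comp t (hUd t))
      ((hw'c.comp hUc).continuousOn.mul (hgc.mono hsub))
    have h1 : 0 ≤ ∫ t in x..y, w' (U t) * g t * g t :=
      intervalIntegral.integral_nonneg hxy fun t _ => by
        rw [mul_assoc]; exact mul_nonneg (hw' _) (mul_self_nonneg _)
    have h2 : ∫ t in x..y, w (U t) * h t ≤ ∫ t in x..y, K t := by
      refine intervalIntegral.integral_mono_ae_restrict hxy
        (ih.continuousOn_mul (hwc.comp hUc).continuousOn) iK ?_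
      have : ∀ᵐ t ∂(volume.restrict (Icc x y)), h t * w (U t) ≤ K t := by
        rw [← restrict_Ioo_eq_restrict_Icc]
        exact ae_restrict_of_ae_restrict_of_subset (Ioo_subset_Ioo hx.1 hy.2) hle
      filter_upwards [this] with t ht
      linarith
    have h3 := potentialDeriv_eq_sub hab hK hx.1 hxy hy.2
    simp only
    linarith
  have hconv : ConvexOn ℝ (Icc a b) fun x => (∫ s in (0 : ℝ)..U x, w s) - potential a b K x := by
    refine MonotoneOn.convexOn_of_deriv (convex_Icc a b)
      (fun x _ => (hWd x).continuousAt.continuousWithinAt)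
      (fun x _ => (hWd x).differentiableAt.differentiableWithinAt) ?_
    intro x hx y hy hxy
    rw [(hWd x).deriv, (hWd y).deriv]
    exact hmono (interior_subset hx) (interior_subset hy) hxy
  -- A convex function that vanishes at both end points is nonpositive between them.
  have h1 := hconv.le_max_of_mem_Icc (left_mem_Icc.2 hab.le) (right_mem_Icc.2 hab.le) hx
  simp only [hU, potential_left, potential_right hab, intervalIntegral.integral_same, sub_zero,
    max_self] at h1
  linarith

theorem potential_le (hab : a < b) {K : ℝ → ℝ} (hK : Integrable K (intervalMeasure a b))
    (hK0 : ∀ᵐ t ∂(intervalMeasure a b), 0 ≤ K t) {x : ℝ} (hx : x ∈ Icc a b) :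
    potential a b K x ≤ (b - a) / 4 * ∫ t, K t ∂(intervalMeasure a b) := by
  rw [← integral_const_mul]
  refine integral_mono_ae (integrable_green_mul hab hK.1 (integrable_weight_of_integrable hK) hx)
    (hK.const_mul _) ?_
  filter_upwards [hK0, ae_mem_Ioo a b] with t ht htm
  have := green_le_quarter (t := t) hab hx
  gcongr

end APriori

/-! ### Regularized powers -/

/-- A `C¹` regularization of the power `s ^ p` of a positive real `s`, defined on all reals. -/
noncomputable def regPow (ε p s : ℝ) : ℝ := (max s 0 ^ 2 + ε ^ 2) ^ (p / 2)

section RegPow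

variable {ε p s : ℝ}

/-- Squaring removes the corner of the positive part at 0, which makes the regularized power
differentiable on all of ℝ. -/
theorem hasDerivAt_max_zero_sq (s : ℝ) : HasDerivAt (fun r : ℝ => max r 0 ^ 2) (2 * max s 0) s := by
  rcases lt_trichotomy s 0 with h | rfl | h
  · rw [max_eq_right h.le, mul_zero]
    refine (hasDerivAt_const s (0 : ℝ)).congr_of_eventuallyEq ?_
    filter_upwards [eventually_lt_nhds h] with r hr
    simp [max_eq_right hr.le]
  · rw [max_self, mul_zero, hasDerivAt_iff_isLittleO]
    have h1 : (fun r : ℝ => max r 0 ^ 2) =O[𝓝 0] fun r => r ^ 2 := by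
      refine Asymptotics.IsBigO.of_bound 1 (Eventually.of_forall fun r => ?_)
      rw [one_mul, norm_pow, norm_pow]
      gcongr
      rw [Real.norm_of_nonneg (le_max_right _ _)]
      exact max_le (Real.le_norm_self r) (norm_nonneg r)
    have h2 := h1.trans_isLittleO
      (Asymptotics.isLittleO_pow_id (𝕜 := ℝ) (one_lt_two))
    simpa using h2
  · rw [max_eq_left h.le]
    have h1 : HasDerivAt (fun r : ℝ => r ^ 2) (2 * s) s := by simpa using hasDerivAt_pow 2 s
    refine h1.congr_of_eventuallyEq ?_
    filter_upwards [eventually_gt_nhds h] with r hr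
    simp [max_eq_left hr.le]

theorem regPow_base_pos (hε : 0 < ε) : 0 < max s 0 ^ 2 + ε ^ 2 := by positivity

theorem regPow_pos (hε : 0 < ε) : 0 < regPow ε p s := Real.rpow_pos_of_pos (regPow_base_pos hε) _

theorem hasDerivAt_regPow (hε : 0 < ε) :
    HasDerivAt (regPow ε p) (p * max s 0 * regPow ε (p - 2) s) s := by
  have h := ((hasDerivAt_max_zero_sq s).add_const (ε ^ 2)).rpow_const (p := p / 2)
    (Or.inl (regPow_base_pos hε).ne')
  convert! h using 1
  rw [regPow, show (p - 2) / 2 = p / 2 - 1 by ring]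
  ring

theorem continuous_regPow (hε : 0 < ε) : Continuous (regPow ε p) :=
  continuous_iff_continuousAt.2 fun _ => (hasDerivAt_regPow hε).continuousAt

theorem regPow_mul_regPow (hε : 0 < ε) (q : ℝ) :
    regPow ε p s * regPow ε q s = regPow ε (p + q) s := by
  rw [regPow, regPow, regPow, ← Real.rpow_add (regPow_base_pos hε), add_div]

theorem regPow_mul_neg (hε : 0 < ε) : regPow ε (-p) s * regPow ε p s = 1 := by
  rw [regPow_mul_regPow hε]; simp [regPow]

theorem sq_rpow_half {r : ℝ} (hr : 0 ≤ r) (p : ℝ) : (r ^ 2) ^ (p / 2) = r ^ p := by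
  rw [← Real.rpow_natCast, ← Real.rpow_mul hr]
  congr 1
  push_cast
  ring

theorem rpow_le_regPow (hp : 0 ≤ p) (hs : 0 ≤ s) : s ^ p ≤ regPow ε p s := by
  rw [← sq_rpow_half hs, regPow, max_eq_left hs]
  gcongr
  linarith [sq_nonneg ε]

theorem regPow_neg_le_rpow (hp : 0 ≤ p) {r : ℝ} (hr : 0 < r) (hrs : r ≤ s) :
    regPow ε (-p) s ≤ r ^ (-p) := by
  rw [← sq_rpow_half hr.le, regPow, max_eq_left (hr.le.trans hrs)]
  refine Real.rpow_le_rpow_of_nonpos (by positivity) ?_ (by linarith)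
  have : r ^ 2 ≤ s ^ 2 := by gcongr
  linarith [sq_nonneg ε]

theorem regPow_neg_le (hε : 0 < ε) (hp : 0 ≤ p) : regPow ε (-p) s ≤ ε ^ (-p) := by
  rw [← sq_rpow_half hε.le, regPow]
  exact Real.rpow_le_rpow_of_nonpos (by positivity) (by linarith [sq_nonneg (max s 0)])
    (by linarith)

theorem rpow_le_regPow_neg (hε : 0 < ε) (hp : 0 ≤ p) {D : ℝ} (hD : 0 ≤ D) (hs : s ≤ D) :
    (D + ε) ^ (-p) ≤ regPow ε (-p) s := by
  rw [← sq_rpow_half (by positivity), regPow]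
  refine Real.rpow_le_rpow_of_nonpos (by positivity) ?_ (by linarith)
  have h1 : max s 0 ≤ D := max_le hs hD
  have h2 : max s 0 ^ 2 ≤ D ^ 2 := by gcongr
  nlinarith

theorem abs_regPow_neg_sub_le (hε : 0 < ε) (hp : 0 ≤ p) (s r : ℝ) :
    |regPow ε (-p) s - regPow ε (-p) r| ≤ p * ε ^ (-(p + 1)) * |s - r| := by
  rw [abs_sub_comm, abs_sub_comm s]
  refine convex_univ.norm_image_sub_le_of_norm_hasDerivWithin_le
    (f' := fun s => -p * max s 0 * regPow ε (-p - 2) s)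
    (fun x _ => (hasDerivAt_regPow hε).hasDerivWithinAt) (fun x _ => ?_) (mem_univ _) (mem_univ _)
  have h1 : max x 0 ≤ regPow ε 1 x := by
    have h2 := sq_rpow_half (le_max_right x 0) 1
    rw [Real.rpow_one] at h2
    rw [regPow]
    conv_lhs => rw [← h2]
    gcongr
    linarith [sq_nonneg ε]
  have h3 : regPow ε 1 x * regPow ε (-p - 2) x ≤ ε ^ (-(p + 1)) := by
    rw [regPow_mul_regPow hε, show 1 + (-p - 2) = -(p + 1) by ring]
    exact regPow_neg_le hε (by linarith)
  rw [norm_mul, norm_mul, norm_neg, Real.norm_of_nonneg hp,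
    Real.norm_of_nonneg (le_max_right _ _), Real.norm_of_nonneg (regPow_pos hε).le, mul_assoc]
  gcongr
  exact (mul_le_mul_of_nonneg_right h1 (regPow_pos hε).le).trans h3

theorem tendsto_regPow {ι : Type*} {l : Filter ι} {e v : ι → ℝ} (he : Tendsto e l (𝓝 0))
    (hv : Tendsto v l (𝓝 s)) (hs : 0 < s) (p : ℝ) :
    Tendsto (fun i => regPow (e i) p (v i)) l (𝓝 (s ^ p)) := by
  have h1 : Tendsto (fun i => max (v i) 0 ^ 2 + e i ^ 2) l (𝓝 (s ^ 2)) := by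
    simpa [max_eq_left hs.le] using
      ((hv.max (tendsto_const_nhds (x := (0 : ℝ)))).pow 2).add (he.pow 2)
  rw [← sq_rpow_half hs.le]
  exact h1.rpow_const (Or.inl (by positivity))

/-- The regularized power dominates r^p on r ≥ 0, so its primitive dominates s^(1+p)/(1+p). The
resulting bound does not depend on ε. -/
theorem le_of_integral_regPow_le (hε : 0 < ε) (hp : 0 ≤ p) {Q D : ℝ} (hD : 0 ≤ D)
    (hQ : (1 + p) * Q ≤ D ^ (1 + p)) (hs : ∫ r in (0 : ℝ)..s, regPow ε p r ≤ Q) : s ≤ D := by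
  rcases le_total s 0 with h | h
  · exact h.trans hD
  have h1 : ∫ r in (0 : ℝ)..s, r ^ p ≤ ∫ r in (0 : ℝ)..s, regPow ε p r :=
    intervalIntegral.integral_mono_on h (intervalIntegral.intervalIntegrable_rpow' (by linarith))
      ((continuous_regPow hε).intervalIntegrable _ _) fun r hr => rpow_le_regPow hp hr.1
  rw [integral_rpow (Or.inl (by linarith)), Real.zero_rpow (by linarith), sub_zero] at h1
  have h2 : s ^ (1 + p) ≤ D ^ (1 + p) := by
    have := (div_le_iff₀ (by linarith : (0 : ℝ) < p + 1)).1 (h1.trans hs)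
    rw [add_comm 1 p] at *
    linarith
  exact (Real.rpow_le_rpow_iff h hD (by linarith)).1 h2

end RegPow

/-! ### Compactness of potentials -/

/-- A family of solutions of linear problems with uniformly controlled right hand sides has a
convergent subsequence. -/
theorem exists_tendsto_potential {a b : ℝ} (hab : a < b) {h : ℕ → ℝ → ℝ} {H : ℝ → ℝ}
    (hm : ∀ n, AEStronglyMeasurable (h n) (intervalMeasure a b))
    (hH : ∀ n, ∀ᵐ t ∂(intervalMeasure a b), |h n t| ≤ H t)
    (hHm : AEStronglyMeasurable H (intervalMeasure a b))
    (hHi : Integrable (fun t => (t - a) * (b - t) * H t) (intervalMeasure a b)) :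
    ∃ v : ℝ → ℝ, Continuous v ∧ ∃ φ : ℕ → ℕ, StrictMono φ ∧
      ∀ x ∈ Icc a b, Tendsto (fun n => potential a b (h (φ n)) x) atTop (𝓝 (v x)) := by
  have h5 := sub_pos.2 hab
  have hH0 : ∀ᵐ t ∂(intervalMeasure a b), 0 ≤ H t :=
    (hH 0).mono fun t ht => (abs_nonneg _).trans ht
  have hGH : ∀ x ∈ Icc a b, Integrable (fun t => green a b x t * H t) (intervalMeasure a b) :=
    fun x hx => integrable_green_mul hab hHm hHi hx
  have hdom : ∀ n, ∀ x, ∀ᵐ t ∂(intervalMeasure a b),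
      ‖green a b x t * h n t‖ ≤ |green a b x t| * H t := fun n x => by
    filter_upwards [hH n] with t ht
    rw [norm_mul, Real.norm_eq_abs, Real.norm_eq_abs]
    gcongr
  have hGm : ∀ x, AEStronglyMeasurable (green a b x) (intervalMeasure a b) := fun x =>
    (continuous_green.comp (Continuous.prodMk_right x)).aestronglyMeasurable
  have hGh : ∀ n, ∀ x ∈ Icc a b,
      Integrable (fun t => green a b x t * h n t) (intervalMeasure a b) := fun n x hx =>
    (hGH x hx).mono' ((hGm x).mul (hm n)) (by
      filter_upwards [hdom n x, ae_mem_Ioo a b] with t ht htm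
      rwa [abs_of_nonneg (green_nonneg hab hx (Ioo_subset_Icc_self htm))] at ht)
  -- This integral is a modulus of continuity common to all the potentials; it is continuous in x by
  -- dominated convergence and vanishes at x₀.
  have hΩ : ∀ x₀ : Icc a b, Continuous fun x : Icc a b =>
      ∫ t, |green a b x t - green a b x₀ t| * H t ∂(intervalMeasure a b) := fun x₀ => by
    refine continuous_of_dominated
      (bound := fun t => (2 / (b - a)) * ((t - a) * (b - t) * H t))
      (fun x => (((hGm x).sub (hGm x₀)).norm).mul hHm) (fun x => ?_) (hHi.const_mul _) ?_
    · filter_upwards [hH0, ae_mem_Ioo a b] with t ht htm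
      have htm' := Ioo_subset_Icc_self htm
      rw [norm_mul, Real.norm_of_nonneg ht, norm_abs_eq_norm, ← mul_assoc]
      gcongr
      have h1 := green_nonneg hab x.2 htm'
      have h2 := green_nonneg hab x₀.2 htm'
      have h3 := green_le_weight hab x.2 htm'
      have h4 := green_le_weight hab x₀.2 htm'
      have h6 : 2 / (b - a) * ((t - a) * (b - t)) = 2 * ((t - a) * (b - t) / (b - a)) := by ring
      rw [h6, Real.norm_eq_abs, abs_le]
      constructor <;> linarith
    · refine Eventually.of_forall fun t => ?_
      have : Continuous fun x : Icc a b => green a b x t :=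
        continuous_green.comp (by fun_prop : Continuous fun x : Icc a b => ((x : ℝ), t))
      fun_prop
  have hmod : ∀ n, ∀ x x₀ : Icc a b, dist (potential a b (h n) x₀) (potential a b (h n) x) ≤
      ∫ t, |green a b x t - green a b x₀ t| * H t ∂(intervalMeasure a b) := fun n x x₀ => by
    rw [dist_comm, Real.dist_eq, potential, potential,
      ← integral_sub (hGh n x x.2) (hGh n x₀ x₀.2), ← Real.norm_eq_abs]
    have hi : Integrable (fun t => |green a b x t - green a b x₀ t| * H t)
        (intervalMeasure a b) := by
      refine ((hGH x x.2).sub (hGH x₀ x₀.2)).norm.congr ?_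
      filter_upwards [hH0] with t ht
      simp only [Pi.sub_apply]
      rw [← sub_mul, norm_mul, Real.norm_of_nonneg ht, Real.norm_eq_abs]
    refine norm_integral_le_of_norm_le hi ?_
    filter_upwards [hH n] with t ht
    rw [← sub_mul, norm_mul, Real.norm_eq_abs, Real.norm_eq_abs]
    gcongr
  have hbase : ∀ x₀ : Icc a b, ∀ ε > 0, ∀ᶠ x : Icc a b in 𝓝 x₀, ∀ n,
      dist (potential a b (h n) x₀) (potential a b (h n) x) < ε := fun x₀ ε hε => by
    have h1 := (hΩ x₀).tendsto x₀
    simp only [sub_self, abs_zero, zero_mul, integral_zero] at h1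
    filter_upwards [h1.eventually_lt_const hε] with x hx n
    exact (hmod n x x₀).trans_lt hx
  have hcont : ∀ n, Continuous fun x : Icc a b => potential a b (h n) x := fun n => by
    rw [Metric.continuous_iff']
    intro x₀ ε hε
    filter_upwards [hbase x₀ ε hε] with x hx
    rw [dist_comm]
    exact hx n
  let F : ℕ → BoundedContinuousFunction (Icc a b) ℝ := fun n =>
    BoundedContinuousFunction.mkOfCompact ⟨fun x => potential a b (h n) x, hcont n⟩
  set R : ℝ := ∫ t, (t - a) * (b - t) * H t / (b - a) ∂(intervalMeasure a b)
  have hFR : ∀ n x, F n x ∈ Icc (-R) R := fun n x => by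
    rw [mem_Icc, ← abs_le, ← Real.norm_eq_abs]
    refine norm_integral_le_of_norm_le (hHi.div_const _) ?_
    filter_upwards [hdom n x, hH0, ae_mem_Ioo a b] with t ht ht0 htm
    have htm' := Ioo_subset_Icc_self htm
    rw [abs_of_nonneg (green_nonneg hab x.2 htm')] at ht
    refine ht.trans ?_
    calc green a b x t * H t ≤ (t - a) * (b - t) / (b - a) * H t := by
          gcongr
          exact green_le_weight hab x.2 htm'
      _ = _ := by ring
  have hcomp : IsCompact (closure (range F)) := by
    refine BoundedContinuousFunction.arzela_ascoli (Icc (-R) R) isCompact_Icc _ ?_ ?_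
    · rintro _ x ⟨n, rfl⟩
      exact hFR n x
    · intro x₀
      rw [Metric.equicontinuousAt_iff_right]
      intro ε hε
      filter_upwards [hbase x₀ ε hε] with x hx
      rintro ⟨_, n, rfl⟩
      exact hx n
  obtain ⟨v, -, φ, hφ, hlim⟩ :=
    hcomp.tendsto_subseq (x := F) fun n => subset_closure (mem_range_self n)
  refine ⟨IccExtend hab.le v, v.continuous.Icc_extend', φ, hφ, fun x hx => ?_⟩
  rw [IccExtend_of_mem _ _ hx]
  exact ((continuous_eval_const (F := BoundedContinuousFunction (Icc a b) ℝ) ⟨x, hx⟩).tendsto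
    v).comp hlim

/-! ### Distance to the boundary and two-sided bounds on potentials -/

section Distance

variable {a b x : ℝ}

theorem bdist_eq_min (hx : x ∈ Icc a b) : bdist a b x = min (x - a) (b - x) := by
  rcases eq_or_lt_of_le (hx.1.trans hx.2) with rfl | hab
  · have : x = a := le_antisymm hx.2 hx.1
    simp [bdist, this]
  rw [bdist, frontier_Ioo hab]
  have h1 : dist x a = x - a := by rw [Real.dist_eq, abs_of_nonneg (by linarith [hx.1])]
  have h2 : dist x b = b - x := by
    rw [dist_comm, Real.dist_eq, abs_of_nonneg (by linarith [hx.2])]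
  refine le_antisymm (le_min ?_ ?_) ((Metric.le_infDist (by simp)).2 ?_)
  · exact (Metric.infDist_le_dist_of_mem (by simp)).trans h1.le
  · exact (Metric.infDist_le_dist_of_mem (by simp)).trans h2.le
  · rintro y (rfl | rfl)
    · exact (min_le_left _ _).trans h1.ge
    · exact (min_le_right _ _).trans h2.ge

theorem continuous_bdist : Continuous (bdist a b) := Metric.continuous_infDist_pt _

theorem bdist_nonneg : 0 ≤ bdist a b x := Metric.infDist_nonneg

theorem bdist_pos (hx : x ∈ Ioo a b) : 0 < bdist a b x := by
  rw [bdist_eq_min (Ioo_subset_Icc_self hx)]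
  exact lt_min (sub_pos.2 hx.1) (sub_pos.2 hx.2)

theorem bdist_le_left (hx : x ∈ Icc a b) : bdist a b x ≤ x - a := by
  rw [bdist_eq_min hx]; exact min_le_left _ _

theorem weight_le_mul_bdist (hx : x ∈ Icc a b) :
    (x - a) * (b - x) ≤ (b - a) * bdist a b x := by
  have h1 := sub_nonneg.2 hx.1
  have h2 := sub_nonneg.2 hx.2
  rw [bdist_eq_min hx]
  rcases min_cases (x - a) (b - x) with ⟨h, -⟩ | ⟨h, -⟩ <;> rw [h] <;> nlinarith

end Distance

section Potential

variable {a b x : ℝ} {h : ℝ → ℝ}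

theorem le_potential (hab : a < b) (hh : Integrable h (intervalMeasure a b))
    (hh0 : ∀ᵐ t ∂(intervalMeasure a b), 0 ≤ h t) (hx : x ∈ Icc a b) :
    bdist a b x / (b - a) * ∫ t, h t * bdist a b t ∂(intervalMeasure a b) ≤ potential a b h x := by
  rw [← integral_const_mul]
  have hi : Integrable (fun t => h t * bdist a b t) (intervalMeasure a b) := by
    refine hh.mul_bdd (c := b - a) continuous_bdist.aestronglyMeasurable ?_
    filter_upwards [ae_mem_Ioo a b] with t ht
    rw [Real.norm_of_nonneg bdist_nonneg]
    linarith [bdist_le_left (Ioo_subset_Icc_self ht), ht.2]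
  refine integral_mono_ae (hi.const_mul _)
    (integrable_green_mul hab hh.1 (integrable_weight_of_integrable hh) hx) ?_
  filter_upwards [hh0, ae_mem_Ioo a b] with t ht htm
  have htm' := Ioo_subset_Icc_self htm
  have h1 := le_green hab hx htm'
  rw [← bdist_eq_min hx, ← bdist_eq_min htm'] at h1
  calc bdist a b x / (b - a) * (h t * bdist a b t) =
      bdist a b x * bdist a b t / (b - a) * h t := by ring
    _ ≤ _ := by gcongr

/-- In the left half the kernel is bounded by (x-a)(b-t)/(b-a), in the right half by
(b-x)(t-a)/(b-a). This is why both weighted integrals of the source must be controlled. -/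
theorem potential_le_mul_bdist (hab : a < b) (hh : Integrable h (intervalMeasure a b))
    (hh0 : ∀ᵐ t ∂(intervalMeasure a b), 0 ≤ h t) {N : ℝ}
    (hleft : ∫ t, (t - a) * h t ∂(intervalMeasure a b) ≤ N)
    (hright : ∫ t, (b - t) * h t ∂(intervalMeasure a b) ≤ N) (hx : x ∈ Icc a b) :
    potential a b h x ≤ bdist a b x / (b - a) * N := by
  have h5 := sub_pos.2 hab
  have hxa := sub_nonneg.2 hx.1
  have hxb := sub_nonneg.2 hx.2
  have hG := integrable_green_mul hab hh.1 (integrable_weight_of_integrable hh) hx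
  have hil : Integrable (fun t => (t - a) * h t) (intervalMeasure a b) := by
    refine hh.bdd_mul (c := b - a) (by fun_prop) ?_
    filter_upwards [ae_mem_Ioo a b] with t ht
    rw [Real.norm_of_nonneg (by linarith [ht.1])]
    linarith [ht.2]
  have hir : Integrable (fun t => (b - t) * h t) (intervalMeasure a b) := by
    refine hh.bdd_mul (c := b - a) (by fun_prop) ?_
    filter_upwards [ae_mem_Ioo a b] with t ht
    rw [Real.norm_of_nonneg (by linarith [ht.2])]
    linarith [ht.1]
  rw [bdist_eq_min hx]
  rcases min_cases (x - a) (b - x) with ⟨e, -⟩ | ⟨e, -⟩ <;> rw [e]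
  · calc potential a b h x ≤
        ∫ t, (x - a) / (b - a) * ((b - t) * h t) ∂(intervalMeasure a b) := by
          refine integral_mono_ae hG (hir.const_mul _) ?_
          filter_upwards [hh0, ae_mem_Ioo a b] with t ht htm
          calc _ ≤ (x - a) * (b - t) / (b - a) * h t := by
                gcongr
                exact green_le_left hab hx
            _ = _ := by ring
      _ ≤ _ := by
          rw [integral_const_mul]
          gcongr
  · calc potential a b h x ≤
        ∫ t, (b - x) / (b - a) * ((t - a) * h t) ∂(intervalMeasure a b) := by
          refine integral_mono_ae hG (hil.const_mul _) ?_
          filter_upwards [hh0, ae_mem_Ioo a b] with t ht htm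
          calc _ ≤ (b - x) * (t - a) / (b - a) * h t := by
                gcongr
                exact green_le_right hab (Ioo_subset_Icc_self htm)
            _ = _ := by ring
      _ ≤ _ := by
          rw [integral_const_mul]
          gcongr

end Potential

/-! ### The regularized problem and its limit -/

section Singular

variable {a b γ lam c D : ℝ} {K M : ℝ → ℝ}

/-- The regularized singular problem has a solution bounded below by a multiple of the distance
to the boundary, uniformly in the regularization. -/
theorem exists_regularized_solution (hab : a < b) (hγ : 0 ≤ γ) (hlam : 0 ≤ lam) (hlam1 : lam ≤ 1)
    (hc : 0 < c) (hK : Integrable K (intervalMeasure a b)) (hM : Integrable M (intervalMeasure a b))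
    (hK0 : ∀ᵐ t ∂(intervalMeasure a b), 0 ≤ K t) (hM0 : ∀ᵐ t ∂(intervalMeasure a b), 0 ≤ M t)
    (hMc : Integrable (fun t => M t * (c * bdist a b t) ^ (-γ)) (intervalMeasure a b))
    (hD : 0 ≤ D)
    (hQ : (1 + γ) * ((b - a) / 4 * ∫ t, K t ∂(intervalMeasure a b)) ≤ D ^ (1 + γ))
    {ε N : ℝ} (hε : 0 < ε)
    (hleft : ∫ t, (t - a) * (M t * (c * bdist a b t) ^ (-γ)) ∂(intervalMeasure a b) ≤ N)
    (hright : ∫ t, (b - t) * (M t * (c * bdist a b t) ^ (-γ)) ∂(intervalMeasure a b) ≤ N)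
    (hN : c * (b - a) + N ≤
      (D + ε) ^ (-γ) * ∫ t, K t * bdist a b t ∂(intervalMeasure a b)) :
    ∃ u : ℝ → ℝ, Continuous u ∧ ∀ x ∈ Icc a b, c * bdist a b x ≤ u x ∧
      u x = potential a b (fun t => K t * regPow ε (-γ) (u t) -
        lam * M t * regPow ε (-γ) (max (u t) (c * bdist a b t))) x := by
  have h5 := sub_pos.2 hab
  have hψ : Continuous (regPow ε (-γ)) := continuous_regPow hε
  set C : ℝ := ε ^ (-γ) + γ * ε ^ (-(γ + 1)) with hC
  have hC1 : ε ^ (-γ) ≤ C := by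
    rw [hC]; linarith [mul_nonneg hγ (Real.rpow_nonneg hε.le (-(γ + 1)))]
  have hC2 : γ * ε ^ (-(γ + 1)) ≤ C := by rw [hC]; linarith [Real.rpow_nonneg hε.le (-γ)]
  have hψC : ∀ s, |regPow ε (-γ) s| ≤ C := fun s => by
    rw [abs_of_pos (regPow_pos hε)]; exact (regPow_neg_le hε hγ).trans hC1
  have hC0 : 0 ≤ C := (abs_nonneg _).trans (hψC 0)
  have hψL : ∀ s r, |regPow ε (-γ) s - regPow ε (-γ) r| ≤ C * |s - r| := fun s r =>
    (abs_regPow_neg_sub_le hε hγ s r).trans (by gcongr)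
  have hmeas : ∀ v : ℝ → ℝ, Continuous v → AEStronglyMeasurable (fun t =>
      K t * regPow ε (-γ) (v t) - lam * M t * regPow ε (-γ) (max (v t) (c * bdist a b t)))
      (intervalMeasure a b) := fun v hv =>
    (hK.1.mul (hψ.comp hv).aestronglyMeasurable).sub ((hM.1.const_mul lam).mul
      (hψ.comp (hv.max (continuous_bdist.const_mul c))).aestronglyMeasurable)
  have hbd : ∀ᵐ t ∂(intervalMeasure a b), ∀ s, |K t * regPow ε (-γ) s -
      lam * M t * regPow ε (-γ) (max s (c * bdist a b t))| ≤ C * (K t + M t) := by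
    filter_upwards [hK0, hM0] with t hKt hMt s
    refine (abs_sub _ _).trans ?_
    rw [abs_mul, abs_mul, abs_of_nonneg hKt, abs_of_nonneg (mul_nonneg hlam hMt)]
    calc _ ≤ K t * C + 1 * M t * C := by
          gcongr
          · exact hψC _
          · exact hψC _
      _ = _ := by ring
  -- Only the M-term is truncated from below at cδ: this bounds the negative part of the equation
  -- before any lower bound on u is known.
  obtain ⟨u, huc, hu⟩ := exists_eq_potential hab (f := fun t s => K t * regPow ε (-γ) s -
      lam * M t * regPow ε (-γ) (max s (c * bdist a b t))) ((hK.add hM).const_mul C) hmeas hbd (by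
    filter_upwards [hK0, hM0] with t hKt hMt s r
    have e : K t * regPow ε (-γ) s - lam * M t * regPow ε (-γ) (max s (c * bdist a b t)) -
        (K t * regPow ε (-γ) r - lam * M t * regPow ε (-γ) (max r (c * bdist a b t))) =
        K t * (regPow ε (-γ) s - regPow ε (-γ) r) - lam * M t *
          (regPow ε (-γ) (max s (c * bdist a b t)) - regPow ε (-γ) (max r (c * bdist a b t))) := by
      ring
    rw [e]
    refine (abs_sub _ _).trans ?_
    rw [abs_mul, abs_mul, abs_of_nonneg hKt, abs_of_nonneg (mul_nonneg hlam hMt)]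
    have h1 := hψL s r
    have h2 := (hψL (max s (c * bdist a b t)) (max r (c * bdist a b t))).trans
      (mul_le_mul_of_nonneg_left (abs_max_sub_max_le_abs s r (c * bdist a b t)) hC0)
    calc _ ≤ K t * (C * |s - r|) + 1 * M t * (C * |s - r|) := by gcongr
      _ = _ := by simp only [Pi.add_apply]; ring)
  have hhi : Integrable (fun t => K t * regPow ε (-γ) (u t) -
      lam * M t * regPow ε (-γ) (max (u t) (c * bdist a b t))) (intervalMeasure a b) :=
    ((hK.add hM).const_mul C).mono' (hmeas u huc) (hbd.mono fun t ht => ht _)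
  -- The multiplier is the reciprocal of the regularized singularity: the K-term becomes K itself
  -- and the M-term is dropped by sign.
  have huD : ∀ x ∈ Icc a b, u x ≤ D := fun x hx => by
    have h1 := primitive_comp_potential_le hab (w := regPow ε γ)
      (w' := fun s => γ * max s 0 * regPow ε (γ - 2) s) hhi hK (fun s => hasDerivAt_regPow hε)
      ((continuous_const.mul (continuous_id.max continuous_const)).mul (continuous_regPow hε))
      (fun s => mul_nonneg (mul_nonneg hγ (le_max_right _ _)) (regPow_pos hε).le)
      (by
        filter_upwards [hM0, ae_mem_Ioo a b] with t hMt ht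
        rw [← hu t (Ioo_subset_Icc_self ht), sub_mul, mul_assoc, regPow_mul_neg hε, mul_one]
        have := mul_nonneg (mul_nonneg (mul_nonneg hlam hMt)
          (regPow_pos (p := -γ) (s := max (u t) (c * bdist a b t)) hε).le)
          (regPow_pos (p := γ) (s := u t) hε).le
        linarith) hx
    rw [← hu x hx] at h1
    exact le_of_integral_regPow_le hε hγ hD hQ (h1.trans (potential_le hab hK hK0 hx))
  refine ⟨u, huc, fun x hx => ⟨?_, hu x hx⟩⟩
  have hDγ : 0 ≤ (D + ε) ^ (-γ) := by positivity
  have hMc0 : ∀ᵐ t ∂(intervalMeasure a b), 0 ≤ M t * (c * bdist a b t) ^ (-γ) := by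
    filter_upwards [hM0] with t ht
    exact mul_nonneg ht (Real.rpow_nonneg (mul_nonneg hc.le bdist_nonneg) _)
  have iK := integrable_green_mul hab hK.1 (integrable_weight_of_integrable hK) hx
  have iM := integrable_green_mul hab hMc.1 (integrable_weight_of_integrable hMc) hx
  have h1 : (D + ε) ^ (-γ) * potential a b K x -
      potential a b (fun t => M t * (c * bdist a b t) ^ (-γ)) x ≤ u x := by
    rw [hu x hx, potential, potential, ← integral_const_mul,
      ← integral_sub (iK.const_mul _) iM]
    refine integral_mono_ae ((iK.const_mul _).sub iM)
      (integrable_green_mul hab hhi.1 (integrable_weight_of_integrable hhi) hx) ?_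
    filter_upwards [hK0, hM0, ae_mem_Ioo a b] with t hKt hMt ht
    have ht' := Ioo_subset_Icc_self ht
    have h2 := rpow_le_regPow_neg hε hγ hD (huD t ht')
    have h3 := regPow_neg_le_rpow (ε := ε) hγ (mul_pos hc (bdist_pos ht))
      (le_max_right (u t) (c * bdist a b t))
    have h4 := green_nonneg hab hx ht'
    have h6 : lam * M t * regPow ε (-γ) (max (u t) (c * bdist a b t)) ≤
        1 * M t * (c * bdist a b t) ^ (-γ) := by
      have := (regPow_pos (p := -γ) (s := max (u t) (c * bdist a b t)) hε).le
      gcongr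
    have h7 : K t * (D + ε) ^ (-γ) ≤ K t * regPow ε (-γ) (u t) := by gcongr
    calc _ = green a b x t * (K t * (D + ε) ^ (-γ) - 1 * M t * (c * bdist a b t) ^ (-γ)) := by
          ring
      _ ≤ _ := by gcongr
  have h2 := mul_le_mul_of_nonneg_left (le_potential hab hK hK0 hx) hDγ
  have h3 := potential_le_mul_bdist hab hMc hMc0 hleft hright hx
  -- This is the step where the smallness condition closes the argument: the lower bound just found
  -- is at least cδ.
  have h4 : bdist a b x / (b - a) * (c * (b - a) + N) ≤ bdist a b x / (b - a) *
      ((D + ε) ^ (-γ) * ∫ t, K t * bdist a b t ∂(intervalMeasure a b)) := by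
    have := bdist_nonneg (a := a) (b := b) (x := x)
    gcongr
  have h6 : bdist a b x / (b - a) * (c * (b - a) + N) =
      c * bdist a b x + bdist a b x / (b - a) * N := by field_simp
  nlinarith

end Singular

section Singular

variable {a b γ lam c D : ℝ} {K M u : ℝ → ℝ}

/-- The weight is at most (b - a)δ, which leaves the power δ^(1-γ), bounded because γ ≤ 1. -/
theorem weight_mul_rpow_le {t : ℝ} (hc : 0 < c) (hγ1 : γ ≤ 1) (ht : t ∈ Ioo a b) :
    (t - a) * (b - t) * (c * bdist a b t) ^ (-γ) ≤ (b - a) * c ^ (-γ) * (b - a) ^ (1 - γ) := by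
  have h1 := bdist_pos ht
  have ht' := Ioo_subset_Icc_self ht
  have h5 : 0 < b - a := by linarith [ht.1, ht.2]
  rw [Real.mul_rpow hc.le h1.le]
  calc _ ≤ (b - a) * bdist a b t * (c ^ (-γ) * bdist a b t ^ (-γ)) := by
        gcongr ?_ * _
        exact weight_le_mul_bdist ht'
    _ = (b - a) * c ^ (-γ) * bdist a b t ^ (1 - γ) := by
        rw [sub_eq_add_neg 1 γ, Real.rpow_add h1, Real.rpow_one]; ring
    _ ≤ _ := by
        gcongr
        linarith [bdist_le_left ht', ht.2]

theorem measurable_rpow_bdist (c γ : ℝ) : Measurable fun t => (c * bdist a b t) ^ (-γ) :=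
  (continuous_bdist.const_mul c).measurable.pow_const _

theorem integrable_weight_mul_rpow_bdist (hc : 0 < c) (hγ1 : γ ≤ 1)
    (hK : Integrable K (intervalMeasure a b)) :
    Integrable (fun t => (t - a) * (b - t) * (K t * (c * bdist a b t) ^ (-γ)))
      (intervalMeasure a b) := by
  have h : Integrable (fun t => (t - a) * (b - t) * (c * bdist a b t) ^ (-γ) * K t)
      (intervalMeasure a b) := by
    refine hK.bdd_mul (c := (b - a) * c ^ (-γ) * (b - a) ^ (1 - γ)) ?_ ?_
    · exact ((by fun_prop : Measurable fun t : ℝ => (t - a) * (b - t)).mul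
        (measurable_rpow_bdist c γ)).aestronglyMeasurable
    · filter_upwards [ae_mem_Ioo a b] with t ht
      rw [Real.norm_of_nonneg]
      · exact weight_mul_rpow_le hc hγ1 ht
      · have h1 := sub_pos.2 ht.1
        have h2 := sub_pos.2 ht.2
        have h3 := bdist_pos ht
        positivity
  refine h.congr (Eventually.of_forall fun t => ?_)
  simp only
  ring

theorem aestronglyMeasurable_singular (hK : AEStronglyMeasurable K (intervalMeasure a b))
    (hM : AEStronglyMeasurable M (intervalMeasure a b)) (hu : Continuous u) :
    AEStronglyMeasurable (fun t => K t * u t ^ (-γ) - lam * M t * u t ^ (-γ))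
      (intervalMeasure a b) := by
  have h := (hu.measurable.pow_const (-γ)).aestronglyMeasurable (μ := intervalMeasure a b)
  exact (hK.mul h).sub ((hM.const_mul lam).mul h)

theorem abs_sub_mul_le {k m r r' R : ℝ} (hk : 0 ≤ k) (hm : 0 ≤ m) (hlam : 0 ≤ lam)
    (hlam1 : lam ≤ 1) (hr : 0 ≤ r) (hr' : 0 ≤ r') (hrR : r ≤ R) (hrR' : r' ≤ R) :
    |k * r - lam * m * r'| ≤ (k + m) * R := by
  refine (abs_sub _ _).trans ?_
  rw [abs_of_nonneg (by positivity), abs_of_nonneg (by positivity)]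
  calc _ ≤ k * R + 1 * m * R := by gcongr
    _ = _ := by ring

/-- The singular problem has a solution bounded below by a multiple of the distance to the
boundary. -/
theorem exists_singular_solution (hab : a < b) (hγ : 0 ≤ γ) (hγ1 : γ ≤ 1) (hlam : 0 ≤ lam)
    (hlam1 : lam ≤ 1)
    (hc : 0 < c) (hK : Integrable K (intervalMeasure a b)) (hM : Integrable M (intervalMeasure a b))
    (hK0 : ∀ᵐ t ∂(intervalMeasure a b), 0 ≤ K t) (hM0 : ∀ᵐ t ∂(intervalMeasure a b), 0 ≤ M t)
    (hMc : Integrable (fun t => M t * (c * bdist a b t) ^ (-γ)) (intervalMeasure a b))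
    (hD : 0 < D)
    (hQ : (1 + γ) * ((b - a) / 4 * ∫ t, K t ∂(intervalMeasure a b)) < D ^ (1 + γ)) {N : ℝ}
    (hleft : ∫ t, (t - a) * (M t * (c * bdist a b t) ^ (-γ)) ∂(intervalMeasure a b) ≤ N)
    (hright : ∫ t, (b - t) * (M t * (c * bdist a b t) ^ (-γ)) ∂(intervalMeasure a b) ≤ N)
    (hN : c * (b - a) + N ≤ D ^ (-γ) * ∫ t, K t * bdist a b t ∂(intervalMeasure a b)) :
    ∃ u : ℝ → ℝ, Continuous u ∧ ∀ x ∈ Icc a b, c * bdist a b x ≤ u x ∧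
      u x = potential a b (fun t => K t * u t ^ (-γ) - lam * M t * u t ^ (-γ)) x := by
  have h5 := sub_pos.2 hab
  set Q : ℝ := (1 + γ) * ((b - a) / 4 * ∫ t, K t ∂(intervalMeasure a b)) with hQd
  have hQ0 : 0 ≤ Q := by
    have : 0 ≤ ∫ t, K t ∂(intervalMeasure a b) := integral_nonneg_of_ae hK0
    positivity
  have hJ0 : 0 ≤ ∫ t, K t * bdist a b t ∂(intervalMeasure a b) := by
    refine integral_nonneg_of_ae ?_
    filter_upwards [hK0] with t ht
    exact mul_nonneg ht bdist_nonneg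
  -- The smallest admissible upper bound. Strictness in `hQ` gives D₀ < D, and the gap is where the
  -- regularization parameters fit: D₀ + ε ≤ D.
  set D₀ : ℝ := Q ^ (1 / (1 + γ)) with hD₀
  have hD₀0 : 0 ≤ D₀ := by positivity
  have hD₀p : D₀ ^ (1 + γ) = Q := by
    rw [hD₀, ← Real.rpow_mul hQ0, one_div_mul_cancel (by linarith), Real.rpow_one]
  have hD₀D : D₀ < D := by
    rw [← hD₀p] at hQ
    exact (Real.rpow_lt_rpow_iff hD₀0 hD.le (by linarith)).1 hQ
  let ε : ℕ → ℝ := fun n => (D - D₀) * (1 / ((n : ℝ) + 1))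
  have hε : ∀ n, 0 < ε n := fun n => by
    have := sub_pos.2 hD₀D
    positivity
  have hεD : ∀ n, D₀ + ε n ≤ D := fun n => by
    have h1 : 1 / ((n : ℝ) + 1) ≤ 1 := by
      rw [div_le_one (by positivity)]; linarith [n.cast_nonneg (α := ℝ)]
    have h2 := mul_le_mul_of_nonneg_left h1 (sub_pos.2 hD₀D).le
    simp only [ε]
    linarith
  have hε0 : Tendsto ε atTop (𝓝 0) := by
    simpa [ε] using (tendsto_one_div_add_atTop_nhds_zero_nat (𝕜 := ℝ)).const_mul (D - D₀)
  have hreg := fun n => exists_regularized_solution (ε := ε n) (D := D₀) hab hγ hlam hlam1 hc hK hM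
    hK0 hM0 hMc hD₀0 hD₀p.ge (hε n) hleft hright (hN.trans (by
      gcongr ?_ * _
      exact Real.rpow_le_rpow_of_nonpos (by linarith [hε n]) (hεD n) (by linarith)))
  choose v hvc hv using hreg
  let h : ℕ → ℝ → ℝ := fun n t => K t * regPow (ε n) (-γ) (v n t) -
    lam * M t * regPow (ε n) (-γ) (max (v n t) (c * bdist a b t))
  -- Common majorant of the right sides. It need not be integrable, but it is after multiplication
  -- by (t-a)(b-t).
  let H : ℝ → ℝ := fun t => (K t + M t) * (c * bdist a b t) ^ (-γ)
  have hHi : Integrable (fun t => (t - a) * (b - t) * H t) (intervalMeasure a b) :=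
    integrable_weight_mul_rpow_bdist hc hγ1 (hK.add hM)
  have hHm : AEStronglyMeasurable H (intervalMeasure a b) :=
    (hK.add hM).1.mul (measurable_rpow_bdist c γ).aestronglyMeasurable
  have hhm : ∀ n, AEStronglyMeasurable (h n) (intervalMeasure a b) := fun n =>
    (hK.1.mul ((continuous_regPow (hε n)).comp (hvc n)).aestronglyMeasurable).sub
      ((hM.1.const_mul lam).mul ((continuous_regPow (hε n)).comp
        ((hvc n).max (continuous_bdist.const_mul c))).aestronglyMeasurable)
  have hhH : ∀ n, ∀ᵐ t ∂(intervalMeasure a b), |h n t| ≤ H t := fun n => by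
    filter_upwards [hK0, hM0, ae_mem_Ioo a b] with t hKt hMt ht
    have hb := mul_pos hc (bdist_pos ht)
    exact abs_sub_mul_le hKt hMt hlam hlam1 (regPow_pos (hε n)).le (regPow_pos (hε n)).le
      (regPow_neg_le_rpow hγ hb (hv n t (Ioo_subset_Icc_self ht)).1)
      (regPow_neg_le_rpow hγ hb (le_max_right _ _))
  obtain ⟨u, huc, φ, hφ, hlim⟩ := exists_tendsto_potential hab hhm hhH hHm hHi
  have hlim' : ∀ x ∈ Icc a b, Tendsto (fun n => v (φ n) x) atTop (𝓝 (u x)) := fun x hx =>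
    (hlim x hx).congr fun n => ((hv (φ n) x hx).2).symm
  have hlow : ∀ x ∈ Icc a b, c * bdist a b x ≤ u x := fun x hx =>
    ge_of_tendsto' (hlim' x hx) fun n => (hv (φ n) x hx).1
  refine ⟨u, huc, fun x hx => ⟨hlow x hx, tendsto_nhds_unique (hlim x hx) ?_⟩⟩
  have hεφ := hε0.comp hφ.tendsto_atTop
  refine tendsto_integral_of_dominated_convergence (fun t => green a b x t * H t)
    (fun n => ?_) (integrable_green_mul hab hHm hHi hx) (fun n => ?_) ?_
  · exact (continuous_green.comp (Continuous.prodMk_right x)).aestronglyMeasurable.mul (hhm _)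
  · filter_upwards [hhH (φ n), ae_mem_Ioo a b] with t ht htm
    have := green_nonneg hab hx (Ioo_subset_Icc_self htm)
    rw [norm_mul, Real.norm_of_nonneg this]
    gcongr
    exact ht
  · filter_upwards [ae_mem_Ioo a b] with t ht
    have ht' := Ioo_subset_Icc_self ht
    have hut : 0 < u t := (mul_pos hc (bdist_pos ht)).trans_le (hlow t ht')
    have h1 := tendsto_regPow hεφ (hlim' t ht') hut (-γ)
    have h2 : Tendsto (fun n => max (v (φ n) t) (c * bdist a b t)) atTop (𝓝 (u t)) := by
      simpa [max_eq_left (hlow t ht')] using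
        (hlim' t ht').max (tendsto_const_nhds (x := c * bdist a b t))
    have h3 := tendsto_regPow hεφ h2 hut (-γ)
    exact ((h1.const_mul (K t)).sub (h3.const_mul (lam * M t))).const_mul (green a b x t)

end Singular

/-! ### Weak formulation and Sobolev regularity -/

section Weak

variable {a b : ℝ} {f g h u φ : ℝ → ℝ}

theorem integrableOn_Icc_of_weight (hm : AEStronglyMeasurable h (intervalMeasure a b))
    (hh : Integrable (fun t => (t - a) * (b - t) * h t) (intervalMeasure a b)) {c d : ℝ}
    (hac : a < c) (hdb : d < b) : IntegrableOn h (Icc c d) := by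
  have hsub : Icc c d ⊆ Ioo a b := Icc_subset_Ioo hac hdb
  have h1 := sub_pos.2 hac
  have h2 := sub_pos.2 hdb
  have hh' : IntegrableOn (fun t => (t - a) * (b - t) * h t) (Icc c d) :=
    IntegrableOn.mono_set hh hsub
  have hm' : AEStronglyMeasurable h (volume.restrict (Icc c d)) :=
    hm.mono_measure (Measure.restrict_mono hsub le_rfl)
  refine (hh'.norm.const_mul (1 / ((c - a) * (b - d)))).mono' hm' ?_
  filter_upwards [ae_restrict_mem measurableSet_Icc] with t ht
  have h3 : c - a ≤ t - a := by linarith [ht.1]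
  have h4 : b - d ≤ b - t := by linarith [ht.2]
  rw [norm_mul, Real.norm_of_nonneg (by nlinarith : 0 ≤ (t - a) * (b - t))]
  calc ‖h t‖ = 1 / ((c - a) * (b - d)) * ((c - a) * (b - d) * ‖h t‖) := by field_simp
    _ ≤ _ := by
        gcongr
        linarith

theorem locallyIntegrableOn_Ioo (hh : ∀ c d, a < c → d < b → IntegrableOn h (Icc c d)) :
    LocallyIntegrableOn h (Ioo a b) := by
  intro x hx
  obtain ⟨c, hac, hcx⟩ := exists_between hx.1
  obtain ⟨d, hxd, hdb⟩ := exists_between hx.2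
  exact ⟨Icc c d, mem_nhdsWithin_of_mem_nhds (Icc_mem_nhds hcx hxd), hh c d hac hdb⟩

theorem IsTestFunction.exists_tsupport_subset (hab : a < b) (hφ : IsTestFunction a b φ) :
    ∃ c d, a < c ∧ c ≤ d ∧ d < b ∧ tsupport φ ⊆ Ioo c d := by
  have hk : IsCompact (tsupport φ) := hφ.compactSupport
  rcases (tsupport φ).eq_empty_or_nonempty with h0 | hne
  · obtain ⟨c, hac, hcb⟩ := exists_between hab
    exact ⟨c, c, hac, le_rfl, hcb, by simp [h0]⟩
  · obtain ⟨x, hx⟩ := hk.exists_isLeast hne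
    obtain ⟨y, hy⟩ := hk.exists_isGreatest hne
    obtain ⟨c, hac, hcx⟩ := exists_between (hφ.support_subset hx.1).1
    obtain ⟨d, hyd, hdb⟩ := exists_between (hφ.support_subset hy.1).2
    refine ⟨c, d, hac, ?_, hdb, fun t ht => ⟨hcx.trans_le (hx.2 ht), (hy.2 ht).trans_lt hyd⟩⟩
    exact (hcx.trans_le ((hx.2 hy.1).trans hyd.le)).le

theorem setIntegral_Ioo_eq_of_tsupport {c d : ℝ} (hac : a < c) (hcd : c ≤ d) (hdb : d < b)
    {F : ℝ → ℝ} (hF : ∀ t, t ∉ Ioo c d → F t = 0) :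
    ∫ t in Ioo a b, F t = ∫ t in c..d, F t := by
  rw [intervalIntegral.integral_of_le hcd]
  refine setIntegral_eq_of_subset_of_forall_sdiff_eq_zero measurableSet_Ioo
    (fun t ht => ⟨hac.trans ht.1, ht.2.trans_lt hdb⟩) fun t ht => hF t fun h => ?_
  exact ht.2 (Ioo_subset_Ioc_self h)

/-- A primitive of a locally integrable function has it as weak derivative. -/
theorem integral_mul_deriv_test (hab : a < b)
    (hh : ∀ c d, a < c → d < b → IntegrableOn h (Icc c d))
    (hg : ∀ x y, a < x → x ≤ y → y < b → g y = g x - ∫ s in x..y, h s)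
    (hφ : IsTestFunction a b φ) :
    ∫ t in Ioo a b, g t * deriv φ t = ∫ t in Ioo a b, h t * φ t := by
  obtain ⟨c, d, hac, hcd, hdb, hsub⟩ := hφ.exists_tsupport_subset hab
  have h0 : ∀ t, t ∉ Ioo c d → φ t = 0 := fun t ht =>
    image_eq_zero_of_notMem_tsupport fun h => ht (hsub h)
  have h0' : ∀ t, t ∉ Ioo c d → deriv φ t = 0 := fun t ht => by
    by_contra hne
    exact ht (hsub (support_deriv_subset hne))
  rw [setIntegral_Ioo_eq_of_tsupport hac hcd hdb fun t ht => by rw [h0' t ht, mul_zero],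
    setIntegral_Ioo_eq_of_tsupport hac hcd hdb fun t ht => by rw [h0 t ht, mul_zero]]
  have key := integral_mul_eq_of_primitive (φ := φ) (φ' := deriv φ) (g := g) (h := h) hcd
    ((intervalIntegrable_iff_integrableOn_Icc_of_le hcd).2 (hh c d hac hdb))
    (fun t ht => hg c t hac ht.1 (ht.2.trans_lt hdb))
    (fun t _ => (hφ.smooth.differentiable (by simp)).differentiableAt.hasDerivAt)
    (hφ.smooth.continuous_deriv (by simp)).continuousOn
  rw [h0 c (by simp), h0 d (by simp)] at key
  simp only [zero_mul, sub_self, zero_add] at key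
  simp only [mul_comm (g _), mul_comm (h _)]
  exact key.symm

theorem continuousOn_of_sub_integral
    (hh : ∀ c d, a < c → d < b → IntegrableOn h (Icc c d))
    (hg : ∀ x y, a < x → x ≤ y → y < b → g y = g x - ∫ s in x..y, h s) :
    ContinuousOn g (Ioo a b) := by
  intro x hx
  obtain ⟨c, hac, hcx⟩ := exists_between hx.1
  obtain ⟨d, hxd, hdb⟩ := exists_between hx.2
  have hcd := (hcx.trans hxd).le
  have h1 := ((intervalIntegrable_iff_integrableOn_Icc_of_le hcd).2
    (hh c d hac hdb)).absolutelyContinuousOnInterval_intervalIntegral (c := c) (by simp)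
  have h2 := h1.continuousOn
  rw [uIcc_of_le hcd] at h2
  have h3 : ContinuousOn g (Icc c d) := (continuousOn_const.sub h2).congr fun y hy =>
    hg c y hac hy.1 (hy.2.trans_lt hdb)
  exact (h3.continuousAt (Icc_mem_nhds hcx hxd)).continuousWithinAt

theorem potentialDeriv_eq_sub_of_weight (hm : AEStronglyMeasurable h (intervalMeasure a b))
    (hh : Integrable (fun t => (t - a) * (b - t) * h t) (intervalMeasure a b))
    (x y : ℝ) (hax : a < x) (hxy : x ≤ y) (hyb : y < b) :
    potentialDeriv a b h y = potentialDeriv a b h x - ∫ t in x..y, h t :=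
  potentialDeriv_sub hax.le hxy hyb.le
    (hasDerivAt_potential_of_weight hm hh ⟨hax, hxy.trans_lt hyb⟩).1
    (hasDerivAt_potential_of_weight hm hh ⟨hax.trans_le hxy, hyb⟩).1

theorem hasDerivAt_of_eq_potential (hm : AEStronglyMeasurable h (intervalMeasure a b))
    (hh : Integrable (fun t => (t - a) * (b - t) * h t) (intervalMeasure a b))
    (hu : ∀ x ∈ Icc a b, u x = potential a b h x) {x : ℝ} (hx : x ∈ Ioo a b) :
    HasDerivAt u (potentialDeriv a b h x) x := by
  refine (hasDerivAt_potential_of_weight hm hh hx).2.congr_of_eventuallyEq ?_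
  filter_upwards [Ioo_mem_nhds hx.1 hx.2] with y hy
  exact hu y (Ioo_subset_Icc_self hy)

/-- A fixed point of the integral operator of the singular problem is a solution. -/
theorem isSolution_of_eq_potential {γ lam : ℝ} {K M : ℝ → ℝ} (hab : a < b)
    (hhd : h = fun t => K t * u t ^ (-γ) - lam * M t * u t ^ (-γ))
    (hm : AEStronglyMeasurable h (intervalMeasure a b))
    (hh : Integrable (fun t => (t - a) * (b - t) * h t) (intervalMeasure a b))
    (huc : Continuous u) (hpos : ∀ x ∈ Ioo a b, 0 < u x)
    (hu : ∀ x ∈ Icc a b, u x = potential a b h x) :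
    IsSolution a b γ γ lam K M u := by
  have hI : ∀ c d, a < c → d < b → IntegrableOn h (Icc c d) := fun c d =>
    integrableOn_Icc_of_weight hm hh
  have hg := potentialDeriv_eq_sub_of_weight hm hh
  have hd : ∀ x ∈ Ioo a b, deriv u x = potentialDeriv a b h x := fun x hx =>
    (hasDerivAt_of_eq_potential hm hh hu hx).deriv
  refine ⟨?_, huc.continuousOn, hpos, ?_, ?_, ?_, fun φ hφ => ?_⟩
  · rw [show (1 : WithTop ℕ∞) = 0 + 1 by simp, contDiffOn_succ_iff_deriv_of_isOpen isOpen_Ioo]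
    refine ⟨fun x hx => (hasDerivAt_of_eq_potential hm hh hu
      hx).differentiableAt.differentiableWithinAt, by simp, ?_⟩
    exact contDiffOn_zero.2 ((continuousOn_of_sub_integral hI hg).congr hd)
  · rw [hu a (left_mem_Icc.2 hab.le), potential_left]
  · rw [hu b (right_mem_Icc.2 hab.le), potential_right hab]
  · rw [← hhd]
    exact locallyIntegrableOn_Ioo hI
  · have key := integral_mul_deriv_test hab hI hg hφ
    rw [hhd] at key hd
    rw [← key]
    exact setIntegral_congr_fun measurableSet_Ioo fun x hx => by simp only [hd x hx]

theorem memLp_of_continuousOn (hg : ContinuousOn g (Icc a b)) (q : ℝ≥0∞) :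
    MemLp g q (intervalMeasure a b) := by
  obtain ⟨C, hC⟩ := isCompact_Icc.exists_bound_of_continuousOn hg
  refine MemLp.of_bound ((hg.mono Ioo_subset_Icc_self).aestronglyMeasurable measurableSet_Ioo) C ?_
  filter_upwards [ae_mem_Ioo a b] with t ht
  exact hC t (Ioo_subset_Icc_self ht)

theorem integrableOn_Icc_of_continuousOn {c d : ℝ} (hg : ContinuousOn g (Icc a b)) (hac : a < c)
    (hdb : d < b) : IntegrableOn g (Icc c d) :=
  (hg.mono (Icc_subset_Icc hac.le hdb.le)).integrableOn_Icc

/-- The weak derivatives are `potentialDeriv` and -h. The test identity is used twice, first with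
-u' in the role of h, because its sign convention is g' = -h. -/
theorem memW2_of_eq_potential (hab : a < b) {q : ℝ≥0∞} (hq : 1 ≤ q)
    (hh : MemLp h q (intervalMeasure a b)) (huc : Continuous u)
    (hu : ∀ x ∈ Icc a b, u x = potential a b h x) : MemW2 a b q u := by
  have hhi : Integrable h (intervalMeasure a b) := hh.integrable hq
  have hhw := integrable_weight_of_integrable hhi
  have hI : ∀ c d, a < c → d < b → IntegrableOn h (Icc c d) := fun c d =>
    integrableOn_Icc_of_weight hh.1 hhw
  have hgc := continuousOn_potentialDeriv hab hhi
  have hgI : ∀ c d, a < c → d < b → IntegrableOn (potentialDeriv a b h) (Icc c d) := fun c d =>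
    integrableOn_Icc_of_continuousOn hgc
  have huI : ∀ c d, a < c → d < b → IntegrableOn u (Icc c d) := fun c d =>
    integrableOn_Icc_of_continuousOn huc.continuousOn
  have hsub : ∀ x y, a < x → x ≤ y → y < b →
      u y = u x - ∫ t in x..y, -potentialDeriv a b h t := fun x y hax hxy hyb => by
    rw [intervalIntegral.integral_neg, intervalIntegral.integral_eq_sub_of_hasDerivAt
      (f := u) (f' := potentialDeriv a b h)]
    · ring
    · intro t ht
      rw [uIcc_of_le hxy] at ht
      exact hasDerivAt_of_eq_potential hh.1 hhw hu ⟨hax.trans_le ht.1, ht.2.trans_lt hyb⟩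
    · exact (intervalIntegrable_iff_integrableOn_Icc_of_le hxy).2 (hgI x y hax hyb)
  refine ⟨potentialDeriv a b h, fun t => -h t, ⟨locallyIntegrableOn_Ioo huI,
    locallyIntegrableOn_Ioo hgI, fun φ hφ => ?_⟩, ⟨locallyIntegrableOn_Ioo hgI,
    locallyIntegrableOn_Ioo fun c d hc hd => (hI c d hc hd).neg, fun φ hφ => ?_⟩,
    memLp_of_continuousOn huc.continuousOn q, memLp_of_continuousOn hgc q, hh.neg⟩
  · rw [integral_mul_deriv_test hab (fun c d hc hd => (hgI c d hc hd).neg) hsub hφ, ← integral_neg]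
    simp
  · rw [integral_mul_deriv_test hab hI (potentialDeriv_eq_sub_of_weight hh.1 hhw) hφ,
      ← integral_neg]
    simp

end Weak

/-! ### Interior of the positive cone -/

section Cone

variable {a b : ℝ}

/-- Mean value inequality from each of the two end points, where w vanishes. -/
theorem C1Zero.abs_le (hab : a < b) (w : C1Zero a b) (x : Icc a b) :
    |w.1.1 x| ≤ ‖w‖ * bdist a b x := by
  set f : ℝ → ℝ := Function.extend (Subtype.val : Icc a b → ℝ) w.1.1 0
  set f' : ℝ → ℝ := IccExtend hab.le w.1.2
  have hf : ∀ y : Icc a b, f y = w.1.1 y := fun y => Subtype.val_injective.extend_apply _ _ y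
  have hd : ∀ y ∈ Icc a b, HasDerivWithinAt f (f' y) (Icc a b) y := fun y hy => by
    have h := w.2.1 ⟨y, hy⟩
    simp only [f']
    rwa [IccExtend_of_mem _ _ hy]
  have hb : ∀ y ∈ Icc a b, ‖f' y‖ ≤ ‖w‖ := fun y hy => by
    simp only [f']
    rw [IccExtend_of_mem _ _ hy]
    exact (w.1.2.norm_coe_le_norm _).trans (norm_snd_le w.1)
  have hmv := fun y (hy : y ∈ Icc a b) =>
    (convex_Icc a b).norm_image_sub_le_of_norm_hasDerivWithin_le
    hd hb hy x.2
  have ha := hmv a (left_mem_Icc.2 hab.le)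
  have hb := hmv b (right_mem_Icc.2 hab.le)
  have fa : f a = 0 := (hf ⟨a, left_mem_Icc.2 hab.le⟩).trans (w.2.2 _ (Or.inl rfl))
  have fb : f b = 0 := (hf ⟨b, right_mem_Icc.2 hab.le⟩).trans (w.2.2 _ (Or.inr rfl))
  rw [fa, sub_zero, hf, Real.norm_eq_abs, Real.norm_of_nonneg (sub_nonneg.2 x.2.1)] at ha
  rw [fb, sub_zero, hf, Real.norm_eq_abs, Real.norm_of_nonpos (sub_nonpos.2 x.2.2), neg_sub] at hb
  rw [bdist_eq_min x.2]
  rcases min_cases ((x : ℝ) - a) (b - x) with ⟨e, -⟩ | ⟨e, -⟩ <;> rw [e] <;> assumption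

/-- A perturbation of C¹ norm below c changes z by at most cδ, so the ball of radius c stays in the
cone. -/
theorem mem_interior_positiveCone (hab : a < b) {c : ℝ} (hc : 0 < c) {z : C1Zero a b}
    (hz : ∀ x : Icc a b, c * bdist a b x ≤ z.1.1 x) : z ∈ interior (positiveCone a b) := by
  rw [mem_interior_iff_mem_nhds]
  refine mem_of_superset (Metric.ball_mem_nhds z hc) fun w hw x => ?_
  rw [mem_ball_iff_norm] at hw
  have h1 := C1Zero.abs_le hab (w - z) x
  have h2 : (w - z).1.1 x = w.1.1 x - z.1.1 x := rfl
  rw [h2] at h1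
  have h3 := mul_le_mul_of_nonneg_right hw.le (bdist_nonneg (a := a) (b := b) (x := x))
  have h4 := (abs_le.1 (h1.trans h3)).1
  have h5 := hz x
  change 0 ≤ w.1.1 x
  linarith

theorem memInteriorCone_of_eq_potential (hab : a < b) {h u : ℝ → ℝ}
    (hh : Integrable h (intervalMeasure a b)) (huc : Continuous u) {c : ℝ} (hc : 0 < c)
    (hu : ∀ x ∈ Icc a b, u x = potential a b h x) (hlow : ∀ x ∈ Icc a b, c * bdist a b x ≤ u x) :
    MemInteriorCone a b u := by
  have hgc := continuousOn_potentialDeriv hab hh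
  let z₁ : C(Icc a b, ℝ) := ⟨fun x => u x, by fun_prop⟩
  let z₂ : C(Icc a b, ℝ) := ⟨fun x => potentialDeriv a b h x, hgc.domRestrict⟩
  have hz : (z₁, z₂) ∈ C1Zero a b := by
    refine ⟨fun x => ?_, fun x hx => ?_⟩
    · refine (hasDerivAt_potential hab hh x).2.hasDerivWithinAt.congr_of_mem (fun y hy => ?_) x.2
      rw [← hu y hy]
      exact Subtype.val_injective.extend_apply z₁ 0 ⟨y, hy⟩
    · have h1 : z₁ x = potential a b h x := hu x x.2
      rcases hx with hx | hx <;> simp only [h1, hx]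
      · exact potential_left
      · exact potential_right hab
  exact ⟨⟨(z₁, z₂), hz⟩, mem_interior_positiveCone hab hc fun x => hlow x x.2, fun x => rfl⟩

end Cone

/-! ### The existence criterion -/

section Existence

variable {a b γ c D : ℝ} {K M : ℝ → ℝ}

theorem mul_rpow_bdist (hc : 0 < c) (t : ℝ) :
    (c * bdist a b t) ^ (-γ) = c ^ (-γ) * bdist a b t ^ (-γ) :=
  Real.mul_rpow hc.le bdist_nonneg

/-- The criterion behind both parts of the theorem. One solution serves every exponent q: the bound
u ≥ cδ majorizes the right side by a multiple of (K + M)δ^(-γ). -/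
theorem exists_isSolution (hab : a < b) (hγ : 0 ≤ γ) (hγ1 : γ ≤ 1) (hc : 0 < c)
    (hK : Integrable K (intervalMeasure a b)) (hM : Integrable M (intervalMeasure a b))
    (hK0 : ∀ᵐ t ∂(intervalMeasure a b), 0 ≤ K t) (hM0 : ∀ᵐ t ∂(intervalMeasure a b), 0 ≤ M t)
    (hMγ : Integrable (fun t => M t * bdist a b t ^ (-γ)) (intervalMeasure a b))
    (hD : 0 < D)
    (hQ : (1 + γ) * ((b - a) / 4 * ∫ t, K t ∂(intervalMeasure a b)) < D ^ (1 + γ)) {N : ℝ}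
    (hleft : ∫ t, (t - a) * (M t * (c * bdist a b t) ^ (-γ)) ∂(intervalMeasure a b) ≤ N)
    (hright : ∫ t, (b - t) * (M t * (c * bdist a b t) ^ (-γ)) ∂(intervalMeasure a b) ≤ N)
    (hN : c * (b - a) + N ≤ D ^ (-γ) * ∫ t, K t * bdist a b t ∂(intervalMeasure a b))
    {lam : ℝ} (hlam : 0 ≤ lam) (hlam1 : lam ≤ 1) :
    ∃ u : ℝ → ℝ, IsSolution a b γ γ lam K M u ∧ ∀ q : ℝ≥0∞, 1 ≤ q →
      MemLp (fun t => K t * bdist a b t ^ (-γ)) q (intervalMeasure a b) →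
      MemLp (fun t => M t * bdist a b t ^ (-γ)) q (intervalMeasure a b) →
      MemW2 a b q u ∧ MemInteriorCone a b u := by
  have hMc : Integrable (fun t => M t * (c * bdist a b t) ^ (-γ)) (intervalMeasure a b) := by
    refine (hMγ.const_mul (c ^ (-γ))).congr (Eventually.of_forall fun t => ?_)
    simp only [mul_rpow_bdist hc]
    ring
  obtain ⟨u, huc, hu⟩ := exists_singular_solution hab hγ hγ1 hlam hlam1 hc hK hM hK0 hM0 hMc hD hQ
    hleft hright hN
  set h : ℝ → ℝ := fun t => K t * u t ^ (-γ) - lam * M t * u t ^ (-γ) with hh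
  have hm : AEStronglyMeasurable h (intervalMeasure a b) :=
    aestronglyMeasurable_singular hK.1 hM.1 huc
  have hpos : ∀ x ∈ Ioo a b, 0 < u x := fun x hx =>
    (mul_pos hc (bdist_pos hx)).trans_le (hu x (Ioo_subset_Icc_self hx)).1
  have hH : ∀ᵐ t ∂(intervalMeasure a b), |h t| ≤ (K t + M t) * (c * bdist a b t) ^ (-γ) := by
    filter_upwards [hK0, hM0, ae_mem_Ioo a b] with t hKt hMt ht
    have h1 : u t ^ (-γ) ≤ (c * bdist a b t) ^ (-γ) :=
      Real.rpow_le_rpow_of_nonpos (mul_pos hc (bdist_pos ht)) (hu t (Ioo_subset_Icc_self ht)).1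
        (by linarith)
    have h2 := Real.rpow_nonneg (hpos t ht).le (-γ)
    exact abs_sub_mul_le hKt hMt hlam hlam1 h2 h2 h1 h1
  have hw : Integrable (fun t => (t - a) * (b - t) * h t) (intervalMeasure a b) := by
    refine (integrable_weight_mul_rpow_bdist hc hγ1 (hK.add hM)).mono'
      ((by fun_prop : Continuous fun t : ℝ => (t - a) * (b - t)).aestronglyMeasurable.mul hm) ?_
    filter_upwards [hH, ae_mem_Ioo a b] with t ht htm
    have h1 := mul_pos (sub_pos.2 htm.1) (sub_pos.2 htm.2)
    rw [norm_mul, Real.norm_of_nonneg h1.le]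
    gcongr
    exact ht
  refine ⟨u, isSolution_of_eq_potential hab hh hm hw huc hpos fun x hx => (hu x hx).2,
    fun q hq hKq hMq => ?_⟩
  have hhq : MemLp h q (intervalMeasure a b) := by
    refine ((hKq.add hMq).const_mul (c ^ (-γ))).mono' hm ?_
    filter_upwards [hH] with t ht
    refine ht.trans (le_of_eq ?_)
    simp only [mul_rpow_bdist hc, Pi.add_apply]
    ring
  exact ⟨memW2_of_eq_potential hab hq hhq huc fun x hx => (hu x hx).2,
    memInteriorCone_of_eq_potential hab (hhq.integrable hq) huc hc (fun x hx => (hu x hx).2)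
      fun x hx => (hu x hx).1⟩

end Existence

/-! ### Powers of the distance, Hölder's inequality and the constant -/

section DistancePowers

variable {a b : ℝ}

theorem integral_rpow_bdist (hab : a < b) {σ : ℝ} (hσ : σ < 1) :
    Integrable (fun t => bdist a b t ^ (-σ)) (intervalMeasure a b) ∧
      ∫ t, bdist a b t ^ (-σ) ∂(intervalMeasure a b) =
        2 * ((b - a) / 2) ^ (1 - σ) / (1 - σ) := by
  set m : ℝ := (a + b) / 2 with hm
  have ham : a ≤ m := by linarith
  have hmb : m ≤ b := by linarith
  have hma : m - a = (b - a) / 2 := by rw [hm]; ring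
  have hbm : b - m = (b - a) / 2 := by rw [hm]; ring
  have e1 : EqOn (fun t => (t - a) ^ (-σ)) (fun t => bdist a b t ^ (-σ)) (uIcc a m) := by
    intro t ht
    rw [uIcc_of_le ham] at ht
    simp only
    rw [bdist_eq_min ⟨ht.1, ht.2.trans hmb⟩, min_eq_left (by linarith [ht.2])]
  have e2 : EqOn (fun t => (b - t) ^ (-σ)) (fun t => bdist a b t ^ (-σ)) (uIcc m b) := by
    intro t ht
    rw [uIcc_of_le hmb] at ht
    simp only
    rw [bdist_eq_min ⟨ham.trans ht.1, ht.2⟩, min_eq_right (by linarith [ht.1])]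
  have i0 : ∀ r, IntervalIntegrable (fun t : ℝ => t ^ (-σ)) volume 0 r := fun r =>
    intervalIntegral.intervalIntegrable_rpow' (by linarith)
  have i1 : IntervalIntegrable (fun t => bdist a b t ^ (-σ)) volume a m := by
    have := (i0 (m - a)).comp_sub_right a
    simp only [zero_add, sub_add_cancel] at this
    exact this.congr (e1.mono uIoc_subset_uIcc)
  have i2 : IntervalIntegrable (fun t => bdist a b t ^ (-σ)) volume m b := by
    have := (i0 (b - m)).comp_sub_left b
    simp only [sub_zero, sub_sub_cancel] at this
    exact this.symm.congr (e2.mono uIoc_subset_uIcc)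
  have j0 : ∫ t in (0 : ℝ)..(b - a) / 2, t ^ (-σ) = ((b - a) / 2) ^ (1 - σ) / (1 - σ) := by
    rw [integral_rpow (Or.inl (by linarith)), Real.zero_rpow (by linarith), sub_zero,
      show -σ + 1 = 1 - σ by ring]
  refine ⟨(integrable_intervalMeasure_iff hab.le).2 (i1.trans i2), ?_⟩
  rw [integral_intervalMeasure hab.le, ← intervalIntegral.integral_add_adjacent_intervals i1 i2,
    ← intervalIntegral.integral_congr e1, ← intervalIntegral.integral_congr e2,
    intervalIntegral.integral_comp_sub_right (fun t => t ^ (-σ)),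
    intervalIntegral.integral_comp_sub_left (fun t => t ^ (-σ)), sub_self, sub_self, hma, hbm, j0]
  ring

theorem memLp_rpow_bdist (hab : a < b) {γ : ℝ} {s : ℝ≥0∞} (hs0 : s ≠ 0) (hs : s ≠ ⊤)
    (hγs : γ * s.toReal < 1) :
    MemLp (fun t => bdist a b t ^ (-γ)) s (intervalMeasure a b) ∧
      lebesgueNorm a b s (fun t => bdist a b t ^ (-γ)) =
        (2 * ((b - a) / 2) ^ (1 - γ * s.toReal) / (1 - γ * s.toReal)) ^ (1 / s.toReal) := by
  obtain ⟨hi, he⟩ := integral_rpow_bdist hab hγs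
  have e : ∀ t, ‖bdist a b t ^ (-γ)‖ ^ s.toReal = bdist a b t ^ (-(γ * s.toReal)) := fun t => by
    rw [Real.norm_of_nonneg (Real.rpow_nonneg bdist_nonneg _), ← Real.rpow_mul bdist_nonneg,
      neg_mul]
  have hm : AEStronglyMeasurable (fun t => bdist a b t ^ (-γ)) (intervalMeasure a b) :=
    (continuous_bdist.measurable.pow_const _).aestronglyMeasurable
  have hL : MemLp (fun t => bdist a b t ^ (-γ)) s (intervalMeasure a b) := by
    rw [← integrable_norm_rpow_iff hm hs0 hs]
    simpa only [e] using hi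
  refine ⟨hL, ?_⟩
  rw [lebesgueNorm, hL.eLpNorm_eq_integral_rpow_norm hs0 hs]
  simp only [e]
  rw [he, ENNReal.toReal_ofReal, one_div]
  have h1 : 0 < 1 - γ * s.toReal := by linarith
  have h2 := sub_pos.2 hab
  positivity

theorem integral_mul_le_lebesgueNorm {p q : ℝ≥0∞} (hpq : p.HolderConjugate q) {f g : ℝ → ℝ}
    (hf : MemLp f p (intervalMeasure a b)) (hg : MemLp g q (intervalMeasure a b)) :
    ∫ t, f t * g t ∂(intervalMeasure a b) ≤ lebesgueNorm a b p f * lebesgueNorm a b q g := by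
  have h1 : eLpNorm (f • g) 1 (intervalMeasure a b) ≤
      eLpNorm f p (intervalMeasure a b) * eLpNorm g q (intervalMeasure a b) :=
    eLpNorm_smul_le_mul_eLpNorm (hpqr := hpq) hg.1 hf.1
  rw [eLpNorm_one_eq_lintegral_enorm] at h1
  have h2 : ‖∫ t, f t * g t ∂(intervalMeasure a b)‖ₑ ≤ _ :=
    (enorm_integral_le_lintegral_enorm _).trans h1
  have h3 := ENNReal.toReal_mono (ENNReal.mul_ne_top hf.2.ne hg.2.ne) h2
  rw [toReal_enorm, ENNReal.toReal_mul] at h3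
  exact (Real.le_norm_self _).trans h3

end DistancePowers

/-- This c is the critical point of c^γ(A - cL), where cL is the fraction γ/(1+γ) of A. The
remaining A/(1+γ) is exactly what the smallness constant times ‖δ^(-γ)‖_{p'} leaves for the M-term.
-/
theorem smallness_identity {γ P L I J : ℝ} (hγ : 0 < γ) (hP : 0 < P) (hγP : γ * P < 1)
    (hL : 0 < L) (hI : 0 < I) (hJ : 0 < J) {D A c : ℝ} (hD : D = (L * I / 2) ^ (1 / (1 + γ)))
    (hA : A = D ^ (-γ) * J) (hc : c = γ * A / ((1 + γ) * L)) :
    c * L + c ^ (-γ) * (γ ^ γ / (γ + 1) ^ (γ + 1) * ((1 - γ * P) ^ (1 / P) / L ^ (γ + 1 / P)) *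
      (J ^ (1 + γ) / I ^ γ) * (2 * (L / 2) ^ (1 - γ * P) / (1 - γ * P)) ^ (1 / P)) = A := by
  have hD0 : 0 < D := by rw [hD]; positivity
  have hA0 : 0 < A := by rw [hA]; positivity
  have hc0 : 0 < c := by rw [hc]; positivity
  have hs : 0 < 1 - γ * P := by linarith
  have h1γ : 0 < 1 + γ := by positivity
  have hcL : c * L = γ * A / (1 + γ) := by rw [hc]; field_simp
  have lD : Real.log D = 1 / (1 + γ) * (Real.log L + Real.log I - Real.log 2) := by
    rw [hD, Real.log_rpow (by positivity), Real.log_div (by positivity) (by positivity),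
      Real.log_mul hL.ne' hI.ne']
  have lA : Real.log A = -γ * Real.log D + Real.log J := by
    rw [hA, Real.log_mul (by positivity) hJ.ne', Real.log_rpow hD0]
  have lc : Real.log c = Real.log γ + Real.log A - (Real.log (1 + γ) + Real.log L) := by
    rw [hc, Real.log_div (by positivity) (by positivity), Real.log_mul hγ.ne' hA0.ne',
      Real.log_mul h1γ.ne' hL.ne']
  have l2 : Real.log (2 * (L / 2) ^ (1 - γ * P) / (1 - γ * P)) =
      Real.log 2 + (1 - γ * P) * (Real.log L - Real.log 2) - Real.log (1 - γ * P) := by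
    rw [Real.log_div (by positivity) hs.ne', Real.log_mul (by positivity) (by positivity),
      Real.log_rpow (by positivity), Real.log_div hL.ne' (by positivity)]
  have key : c ^ (-γ) * (γ ^ γ / (γ + 1) ^ (γ + 1) * ((1 - γ * P) ^ (1 / P) / L ^ (γ + 1 / P)) *
      (J ^ (1 + γ) / I ^ γ) * (2 * (L / 2) ^ (1 - γ * P) / (1 - γ * P)) ^ (1 / P)) =
      A / (1 + γ) := by
    -- All factors are positive powers, so after taking logarithms the identity is linear in the
    -- logarithms of the data.
    refine Real.log_injOn_pos (mem_Ioi.2 (by positivity)) (mem_Ioi.2 (by positivity)) ?_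
    rw [Real.log_mul (by positivity) (by positivity), Real.log_mul (by positivity) (by positivity),
      Real.log_mul (by positivity) (by positivity), Real.log_mul (by positivity) (by positivity),
      Real.log_div (by positivity) (by positivity), Real.log_div (by positivity) (by positivity),
      Real.log_div (by positivity) (by positivity), Real.log_div (by positivity) (by positivity),
      Real.log_rpow hc0, Real.log_rpow hγ, Real.log_rpow (by positivity), Real.log_rpow hs,
      Real.log_rpow hL, Real.log_rpow hJ, Real.log_rpow hI, Real.log_rpow (by positivity), l2, lc,
      lA, lD, add_comm γ 1]
    field_simp
    ring
  rw [hcL, key]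
  field_simp
  ring

/-! ### Part (i): smallness in a Lebesgue norm -/

section Exponents

variable {a b : ℝ}

/-- The product of an `L^p` function and a power of the distance that is slightly better than
`L^{p'}` belongs to some `L^q` with `1 < q < ∞`. -/
theorem exists_exponent {p p' s : ℝ≥0∞} (hpp : p.HolderConjugate p') (hs : p' < s) (hs' : s ≠ ⊤)
    (hp : 1 ≤ p) :
    ∃ q : ℝ≥0∞, 1 < q ∧ q < ⊤ ∧ ∀ f g : ℝ → ℝ, MemLp f p (intervalMeasure a b) →
      MemLp g s (intervalMeasure a b) → MemLp (fun t => f t * g t) q (intervalMeasure a b) := by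
  refine ⟨(p⁻¹ + s⁻¹)⁻¹, ?_, ?_, fun f g hf hg => ?_⟩
  · have h1 : p⁻¹ + p'⁻¹ = 1 := hpp.inv_add_inv_eq_one
    rw [ENNReal.one_lt_inv, ← h1]
    refine ENNReal.add_lt_add_left ?_ (ENNReal.inv_lt_inv.2 hs)
    simpa using (zero_lt_one.trans_le hp).ne'
  · rw [ENNReal.inv_lt_top]
    exact (ENNReal.inv_pos.2 hs').trans_le le_add_self
  · have : ENNReal.HolderTriple p s (p⁻¹ + s⁻¹)⁻¹ := ⟨by simp⟩
    exact hg.mul' hf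

theorem memLp_weight_mul {p : ℝ≥0∞} {M : ℝ → ℝ} (hM : MemLp M p (intervalMeasure a b))
    {ω : ℝ → ℝ} (hω : Continuous ω) : MemLp (fun t => ω t * M t) p (intervalMeasure a b) :=
  MemLp.mul' (r := p) hM (memLp_of_continuousOn hω.continuousOn ⊤)

end Exponents

section Theorems

variable {a b : ℝ} {K M : ℝ → ℝ}

theorem integral_mul_pos_of_not_ae_zero (hK : Integrable K (intervalMeasure a b))
    (hK0 : ∀ᵐ x ∂(intervalMeasure a b), 0 ≤ K x)
    (hKne : ¬ ∀ᵐ x ∂(intervalMeasure a b), K x = 0) {ω : ℝ → ℝ} (hωc : Continuous ω)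
    (hω : ∀ x ∈ Ioo a b, 0 < ω x) : 0 < ∫ t, K t * ω t ∂(intervalMeasure a b) := by
  have hn : 0 ≤ᵐ[intervalMeasure a b] fun t => K t * ω t := by
    filter_upwards [hK0, ae_mem_Ioo a b] with t ht htm
    exact mul_nonneg ht (hω t htm).le
  refine (integral_nonneg_of_ae hn).lt_of_ne' fun h0 => hKne ?_
  have hi : Integrable (fun t => K t * ω t) (intervalMeasure a b) := by
    have := memLp_weight_mul (memLp_one_iff_integrable.2 hK) hωc
    simpa only [mul_comm (ω _)] using memLp_one_iff_integrable.1 this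
  filter_upwards [(integral_eq_zero_iff_of_nonneg_ae hn hi).1 h0, ae_mem_Ioo a b] with t ht htm
  exact (mul_eq_zero.1 ht).resolve_right (hω t htm).ne'

theorem integral_weight_mul_rpow_le {γ c : ℝ} (hc : 0 < c) {p p' : ℝ≥0∞}
    (hpp : p.HolderConjugate p') (hM : MemLp M p (intervalMeasure a b)) {ω : ℝ → ℝ}
    (hω : Continuous ω)
    (hδ : MemLp (fun t => bdist a b t ^ (-γ)) p' (intervalMeasure a b)) {X : ℝ}
    (hX : lebesgueNorm a b p (fun t => ω t * M t) ≤ X) :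
    ∫ t, ω t * (M t * (c * bdist a b t) ^ (-γ)) ∂(intervalMeasure a b) ≤
      c ^ (-γ) * (X * lebesgueNorm a b p' (fun t => bdist a b t ^ (-γ))) := by
  have e : ∀ t, ω t * (M t * (c * bdist a b t) ^ (-γ)) =
      c ^ (-γ) * (ω t * M t * bdist a b t ^ (-γ)) := fun t => by
    rw [mul_rpow_bdist hc]; ring
  simp only [e]
  rw [integral_const_mul]
  have h0 : 0 ≤ lebesgueNorm a b p' (fun t => bdist a b t ^ (-γ)) := ENNReal.toReal_nonneg
  gcongr
  exact (integral_mul_le_lebesgueNorm hpp (memLp_weight_mul hM hω) hδ).trans (by gcongr)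

/-- Existence of solutions under a smallness condition on `M` in `L^p`. -/
theorem exists_solution_of_lebesgueNorm_le (hab : a < b)
    (hK : MemLp K 2 (intervalMeasure a b)) (hM2 : MemLp M 2 (intervalMeasure a b))
    (hK0 : ∀ᵐ x ∂(intervalMeasure a b), 0 ≤ K x)
    (hM0 : ∀ᵐ x ∂(intervalMeasure a b), 0 ≤ M x)
    (hKne : ¬ ∀ᵐ x ∂(intervalMeasure a b), K x = 0)
    {p : ℝ≥0∞} {γ : ℝ} (hp : 2 ≤ p) (hM : MemLp M p (intervalMeasure a b))
    (hγ : 0 < γ) (hγp : γ < 1 / conjExp p)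
    (hle : max (lebesgueNorm a b p (leftWeighted a M)) (lebesgueNorm a b p (rightWeighted b M)) ≤
        smallnessConst γ p a b *
          ((∫ t in a..b, K t * bdist a b t) ^ (1 + γ) / (∫ t in a..b, K t) ^ γ)) :
    ∃ q : ℝ≥0∞, 1 < q ∧ q < ⊤ ∧ ∀ lam : ℝ, 0 < lam → lam ≤ 1 →
      ∃ u : ℝ → ℝ, IsSolution a b γ γ lam K M u ∧
        ((∃ r : ℝ≥0∞, 1 < r ∧
            MemLp (fun x => K x * bdist a b x ^ (-γ)) r (intervalMeasure a b)) →
          MemW2 a b q u ∧ MemInteriorCone a b u) := by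
  have hL := sub_pos.2 hab
  have hKi : Integrable K (intervalMeasure a b) := hK.integrable one_le_two
  have hMi : Integrable M (intervalMeasure a b) := hM2.integrable one_le_two
  have hp1 : 1 ≤ p := one_le_two.trans hp
  have hpp : p.HolderConjugate (ENNReal.conjExponent p) := .conjExponent hp1
  set p' := ENNReal.conjExponent p with hp'
  have hp1' : 1 ≤ p' := by rw [hp', ENNReal.conjExponent]; exact le_self_add
  have hpt' : p' ≠ ⊤ := by
    have : p - 1 ≠ 0 := by
      rw [ne_eq, tsub_eq_zero_iff_le, not_le]
      exact ENNReal.one_lt_two.trans_le hp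
    rw [hp', ENNReal.conjExponent]
    simp [this]
  set P : ℝ := conjExp p with hPdef
  have hPp : P = p'.toReal := rfl
  have hP1 : 1 ≤ P := by
    rw [hPp]; simpa using (ENNReal.toReal_le_toReal ENNReal.one_ne_top hpt').2 hp1'
  have hP0 : 0 < P := by linarith
  have hγP : γ * P < 1 := (lt_div_iff₀ hP0).1 hγp
  have hγ1 : γ < 1 := by nlinarith
  -- With s strictly between p' and 1/γ, δ^(-γ) lies in L^s, and the product with M gains an
  -- exponent q > 1.
  obtain ⟨s, hPs, hsγ⟩ := exists_between ((lt_div_iff₀ hγ).2 (by rwa [mul_comm]) : P < 1 / γ)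
  have hs0 : 0 < s := hP0.trans hPs
  have hγs : γ * s < 1 := by rw [mul_comm]; exact (lt_div_iff₀ hγ).1 hsγ
  have hps' : p' < ENNReal.ofReal s := by
    rw [ENNReal.lt_ofReal_iff_toReal_lt hpt']; exact hPs
  obtain ⟨q, hq1, hqt, hq⟩ := exists_exponent (a := a) (b := b) hpp hps' ENNReal.ofReal_ne_top hp1
  have hδs := (memLp_rpow_bdist hab (γ := γ) (s := ENNReal.ofReal s) (by simpa using hs0)
    ENNReal.ofReal_ne_top (by rwa [ENNReal.toReal_ofReal hs0.le])).1
  have hMq := hq _ _ hM hδs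
  obtain ⟨hδ, hδn⟩ := memLp_rpow_bdist hab (γ := γ) (s := p') (zero_lt_one.trans_le hp1').ne' hpt'
    (by rwa [← hPp])
  set I : ℝ := ∫ t in a..b, K t with hI
  set J : ℝ := ∫ t in a..b, K t * bdist a b t with hJ
  have hI' : ∫ t, K t ∂(intervalMeasure a b) = I := integral_intervalMeasure hab.le _
  have hJ' : ∫ t, K t * bdist a b t ∂(intervalMeasure a b) = J := integral_intervalMeasure hab.le _
  have hI0 : 0 < I := by
    have := integral_mul_pos_of_not_ae_zero hKi hK0 hKne (ω := fun _ => 1) continuous_const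
      fun _ _ => one_pos
    simpa [hI'] using this
  have hJ0 : 0 < J := hJ' ▸ integral_mul_pos_of_not_ae_zero hKi hK0 hKne continuous_bdist
    fun _ => bdist_pos
  set X : ℝ := smallnessConst γ p a b * (J ^ (1 + γ) / I ^ γ) with hX
  -- D^(1+γ) = LI/2 exceeds the required (1+γ)LI/4 because γ < 1; A is the budget D^(-γ)J and c its
  -- optimal split.
  obtain ⟨D, hD⟩ : ∃ D, D = ((b - a) * I / 2) ^ (1 / (1 + γ)) := ⟨_, rfl⟩
  obtain ⟨A, hA⟩ : ∃ A, A = D ^ (-γ) * J := ⟨_, rfl⟩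
  obtain ⟨c, hc⟩ : ∃ c, c = γ * A / ((1 + γ) * (b - a)) := ⟨_, rfl⟩
  have hD0 : 0 < D := by rw [hD]; positivity
  have hA0 : 0 < A := by rw [hA]; positivity
  have hc0 : 0 < c := by rw [hc]; positivity
  have hid := smallness_identity hγ hP0 hγP hL hI0 hJ0 hD hA hc
  have hQ : (1 + γ) * ((b - a) / 4 * I) < D ^ (1 + γ) := by
    rw [hD, ← Real.rpow_mul (by positivity), one_div_mul_cancel (by linarith), Real.rpow_one]
    have := mul_pos hL hI0
    nlinarith
  have hexist := fun (lam : ℝ) (h0 : 0 ≤ lam) (h1 : lam ≤ 1) =>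
    exists_isSolution (D := D) (N := c ^ (-γ) *
      (X * lebesgueNorm a b p' (fun t => bdist a b t ^ (-γ)))) hab hγ.le hγ1.le hc0 hKi hMi hK0 hM0
      (hMq.integrable hq1.le) hD0 (by rwa [hI'])
      (integral_weight_mul_rpow_le hc0 hpp hM (by fun_prop) hδ ((le_max_left _ _).trans hle))
      (integral_weight_mul_rpow_le hc0 hpp hM (by fun_prop) hδ ((le_max_right _ _).trans hle))
      (by rw [hJ', ← hA, hδn, hX, smallnessConst, ← hPdef, ← hPp]; exact hid.le) h0 h1
  -- q has to be fixed before r is given, but the integrability of Kδ^(-γ) does not involve λ or u,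
  -- so it can be decided beforehand.
  by_cases hr : ∃ r : ℝ≥0∞, 1 < r ∧
      MemLp (fun x => K x * bdist a b x ^ (-γ)) r (intervalMeasure a b)
  · obtain ⟨r, hr1, hKr⟩ := hr
    refine ⟨min q r, lt_min hq1 hr1, (min_le_left _ _).trans_lt hqt, fun lam h0 h1 => ?_⟩
    obtain ⟨u, hu, huq⟩ := hexist lam h0.le h1
    exact ⟨u, hu, fun _ => huq _ (lt_min hq1 hr1).le (hKr.mono_exponent (min_le_right _ _))
      (hMq.mono_exponent (min_le_left _ _))⟩
  · refine ⟨q, hq1, hqt, fun lam h0 h1 => ?_⟩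
    obtain ⟨u, hu, -⟩ := hexist lam h0.le h1
    exact ⟨u, hu, fun h => absurd h hr⟩

end Theorems

/-! ### Part (ii): small exponents -/

section Theorems

variable {a b : ℝ} {K M : ℝ → ℝ}

/-- Dominated convergence: for 0 < γ ≤ σ, the power y^(-γ) is at most 1 if y ≥ 1 and at most y^(-σ)
if y ≤ 1. -/
theorem tendsto_integral_weight_mul_rpow {c : ℝ} (hc : 0 < c) {ω : ℝ → ℝ} (hω : Continuous ω)
    {σ : ℝ} (hσ : 0 < σ) (hM : Integrable M (intervalMeasure a b))
    (hMσ : Integrable (fun t => M t * (c * bdist a b t) ^ (-σ)) (intervalMeasure a b)) :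
    Tendsto (fun γ : ℝ => ∫ t, ω t * (M t * (c * bdist a b t) ^ (-γ)) ∂(intervalMeasure a b))
      (𝓝[>] 0) (𝓝 (∫ t, ω t * M t ∂(intervalMeasure a b))) := by
  have hωI : ∀ f, Integrable f (intervalMeasure a b) →
      Integrable (fun t => ω t * f t) (intervalMeasure a b) := fun f hf =>
    memLp_one_iff_integrable.1 (memLp_weight_mul (memLp_one_iff_integrable.2 hf) hω)
  refine tendsto_integral_filter_of_dominated_convergence
    (fun t => ‖ω t * M t‖ + ‖ω t * (M t * (c * bdist a b t) ^ (-σ))‖)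
    (Eventually.of_forall fun γ => ?_) ?_ ((hωI _ hM).norm.add (hωI _ hMσ).norm) ?_
  · exact hω.aestronglyMeasurable.mul (hM.1.mul (measurable_rpow_bdist c γ).aestronglyMeasurable)
  · filter_upwards [Ioc_mem_nhdsGT hσ] with γ hγ
    filter_upwards [ae_mem_Ioo a b] with t ht
    have hb := mul_pos hc (bdist_pos ht)
    have h1 : (c * bdist a b t) ^ (-γ) ≤ 1 + (c * bdist a b t) ^ (-σ) := by
      have h2 := Real.rpow_nonneg hb.le (-σ)
      rcases le_total 1 (c * bdist a b t) with h | h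
      · linarith [Real.rpow_le_one_of_one_le_of_nonpos h (by linarith [hγ.1] : -γ ≤ 0)]
      · linarith [Real.rpow_le_rpow_of_exponent_ge hb h (by linarith [hγ.2] : -σ ≤ -γ)]
    simp only [norm_mul, Real.norm_of_nonneg (Real.rpow_nonneg hb.le _)]
    calc _ ≤ ‖ω t‖ * (‖M t‖ * (1 + (c * bdist a b t) ^ (-σ))) := by gcongr
      _ = _ := by ring
  · filter_upwards [ae_mem_Ioo a b] with t ht
    have hb := mul_pos hc (bdist_pos ht)
    have h1 : Tendsto (fun γ : ℝ => (c * bdist a b t) ^ (-γ)) (𝓝[>] 0) (𝓝 1) := by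
      have : ContinuousAt (fun γ : ℝ => (c * bdist a b t) ^ (-γ)) 0 :=
        (Real.continuousAt_const_rpow hb.ne').comp_of_eq continuousAt_neg rfl
      simpa using this.tendsto.mono_left nhdsWithin_le_nhds
    simpa using (h1.const_mul (M t)).const_mul (ω t)

/-- Existence of strictly positive solutions for all small exponents. -/
theorem exists_solution_of_integral_lt (hab : a < b)
    (hK : MemLp K 2 (intervalMeasure a b)) (hM : MemLp M 2 (intervalMeasure a b))
    (hK0 : ∀ᵐ x ∂(intervalMeasure a b), 0 ≤ K x)
    (hM0 : ∀ᵐ x ∂(intervalMeasure a b), 0 ≤ M x)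
    (hlt : max (∫ t in a..b, leftWeighted a M t) (∫ t in a..b, rightWeighted b M t) <
        ∫ t in a..b, K t * bdist a b t) :
    ∃ γ₀ : ℝ, 0 < γ₀ ∧ ∃ q : ℝ≥0∞, 1 < q ∧ q < ⊤ ∧
      ∀ γ : ℝ, 0 < γ → γ ≤ γ₀ → ∀ lam : ℝ, 0 < lam → lam ≤ 1 →
        ∃ u : ℝ → ℝ, IsSolution a b γ γ lam K M u ∧ MemW2 a b q u ∧ MemInteriorCone a b u := by
  have hL := sub_pos.2 hab
  have hKi : Integrable K (intervalMeasure a b) := hK.integrable one_le_two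
  have hMi : Integrable M (intervalMeasure a b) := hM.integrable one_le_two
  simp only [← integral_intervalMeasure hab.le] at hlt
  set J : ℝ := ∫ t, K t * bdist a b t ∂(intervalMeasure a b)
  set I : ℝ := ∫ t, K t ∂(intervalMeasure a b)
  set N₀ : ℝ := max (∫ t, leftWeighted a M t ∂(intervalMeasure a b))
    (∫ t, rightWeighted b M t ∂(intervalMeasure a b))
  have hI0 : 0 ≤ I := integral_nonneg_of_ae hK0
  -- K and M are in L², and δ^(-γ) is in L⁴ for γ ≤ 1/8; one q then works for all these γ.
  obtain ⟨q, hq1, hqt, hq⟩ := exists_exponent (a := a) (b := b) (p := 2) (p' := 2) (s := 4)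
    ⟨by simpa using ENNReal.inv_two_add_inv_two⟩ (by norm_num) (by simp) one_le_two
  have hδ : ∀ γ : ℝ, γ ≤ 1 / 8 →
      MemLp (fun t => bdist a b t ^ (-γ)) 4 (intervalMeasure a b) := fun γ hγ =>
    (memLp_rpow_bdist hab (by simp) (by simp) (by norm_num; linarith)).1
  have hMγ : ∀ γ : ℝ, γ ≤ 1 / 8 →
      MemLp (fun t => M t * bdist a b t ^ (-γ)) q (intervalMeasure a b) := fun γ hγ =>
    hq _ _ hM (hδ γ hγ)
  -- The gap J - N₀ is split: half to cL, a quarter to the error in N, a quarter to the loss from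
  -- D^(-γ).
  set c : ℝ := (J - N₀) / (2 * (b - a)) with hc
  have hc0 : 0 < c := div_pos (sub_pos.2 hlt) (by positivity)
  have hcL : c * (b - a) = (J - N₀) / 2 := by rw [hc]; field_simp
  set N : ℝ := N₀ + (J - N₀) / 4 with hN
  have hNN : N₀ < N := by linarith
  -- D ≥ 1 gives D ≤ D^(1+γ), so a single D meets the upper bound condition for every γ ≤ 1/8.
  set D : ℝ := max 1 ((b - a) * I) with hD
  have hD1 : 1 ≤ D := le_max_left _ _
  have hMσ : Integrable (fun t => M t * (c * bdist a b t) ^ (-(1 / 8 : ℝ)))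
      (intervalMeasure a b) := by
    refine (((hMγ _ le_rfl).integrable hq1.le).const_mul (c ^ (-(1 / 8 : ℝ)))).congr
      (Eventually.of_forall fun t => ?_)
    simp only [mul_rpow_bdist hc0]
    ring
  have hev : ∀ᶠ γ : ℝ in 𝓝[>] 0, J - (J - N₀) / 4 < D ^ (-γ) * J ∧
      ∫ t, (t - a) * (M t * (c * bdist a b t) ^ (-γ)) ∂(intervalMeasure a b) < N ∧
      ∫ t, (b - t) * (M t * (c * bdist a b t) ^ (-γ)) ∂(intervalMeasure a b) < N := by
    have h1 : Tendsto (fun γ : ℝ => D ^ (-γ) * J) (𝓝[>] 0) (𝓝 J) := by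
      have : ContinuousAt (fun γ : ℝ => D ^ (-γ)) 0 :=
        (Real.continuousAt_const_rpow (by linarith)).comp_of_eq continuousAt_neg rfl
      simpa using (this.tendsto.mono_left nhdsWithin_le_nhds).mul_const J
    have h2 := tendsto_integral_weight_mul_rpow hc0 (by fun_prop : Continuous fun t : ℝ => t - a)
      (by norm_num) hMi hMσ
    have h3 := tendsto_integral_weight_mul_rpow hc0 (by fun_prop : Continuous fun t : ℝ => b - t)
      (by norm_num) hMi hMσ
    exact (h1.eventually_const_lt (by linarith)).and
      ((h2.eventually_lt_const ((le_max_left _ _).trans_lt hNN)).and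
        (h3.eventually_lt_const ((le_max_right _ _).trans_lt hNN)))
  obtain ⟨γ₁, hγ₁, hγ₁h⟩ := (mem_nhdsGT_iff_exists_Ioc_subset).1 hev
  refine ⟨min γ₁ (1 / 8), lt_min hγ₁ (by norm_num), q, hq1, hqt, fun γ hγ0 hγ lam h0 h1 => ?_⟩
  have hγ8 : γ ≤ 1 / 8 := hγ.trans (min_le_right _ _)
  obtain ⟨e1, e2, e3⟩ := hγ₁h ⟨hγ0, hγ.trans (min_le_left _ _)⟩
  have hQ : (1 + γ) * ((b - a) / 4 * I) < D ^ (1 + γ) := by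
    have h2 : D ≤ D ^ (1 + γ) := by
      simpa using Real.rpow_le_rpow_of_exponent_le hD1 (by linarith : (1 : ℝ) ≤ 1 + γ)
    have h3 : (b - a) * I ≤ D := le_max_right _ _
    have h4 := mul_nonneg hL.le hI0
    nlinarith
  obtain ⟨u, hu, hreg⟩ := exists_isSolution hab hγ0.le (by linarith) hc0 hKi hMi hK0 hM0
    ((hMγ γ hγ8).integrable hq1.le) (by linarith) hQ e2.le e3.le (by rw [hcL]; linarith) h0.le h1
  exact ⟨u, hu, hreg q hq1.le (hq _ _ hK (hδ γ hγ8)) (hMγ γ hγ8)⟩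

end Theorems

theorem mainTheorem1 (a b : ℝ) (hab : a < b) (K M : ℝ → ℝ)
    (hK : MemLp K 2 (intervalMeasure a b)) (hM : MemLp M 2 (intervalMeasure a b))
    (hK0 : ∀ᵐ x ∂(intervalMeasure a b), 0 ≤ K x)
    (hM0 : ∀ᵐ x ∂(intervalMeasure a b), 0 ≤ M x)
    (hKne : ¬ ∀ᵐ x ∂(intervalMeasure a b), K x = 0) :
    (∀ (p : ℝ≥0∞) (γ : ℝ), 2 ≤ p → MemLp M p (intervalMeasure a b) →
      0 < γ → γ < 1 / conjExp p →
      max (lebesgueNorm a b p (leftWeighted a M)) (lebesgueNorm a b p (rightWeighted b M)) ≤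
        smallnessConst γ p a b *
          ((∫ t in a..b, K t * bdist a b t) ^ (1 + γ) / (∫ t in a..b, K t) ^ γ) →
      ∃ q : ℝ≥0∞, 1 < q ∧ q < ⊤ ∧ ∀ lam : ℝ, 0 < lam → lam ≤ 1 →
        ∃ u : ℝ → ℝ, IsSolution a b γ γ lam K M u ∧
          ((∃ r : ℝ≥0∞, 1 < r ∧
              MemLp (fun x => K x * bdist a b x ^ (-γ)) r (intervalMeasure a b)) →
            MemW2 a b q u ∧ MemInteriorCone a b u)) ∧
    (max (∫ t in a..b, leftWeighted a M t) (∫ t in a..b, rightWeighted b M t) <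
        ∫ t in a..b, K t * bdist a b t →
      ∃ γ₀ : ℝ, 0 < γ₀ ∧ ∃ q : ℝ≥0∞, 1 < q ∧ q < ⊤ ∧
        ∀ γ : ℝ, 0 < γ → γ ≤ γ₀ → ∀ lam : ℝ, 0 < lam → lam ≤ 1 →
          ∃ u : ℝ → ℝ, IsSolution a b γ γ lam K M u ∧ MemW2 a b q u ∧
            MemInteriorCone a b u) := by
  exact ⟨fun _ _ hp hMp hγ hγp hle =>
    exists_solution_of_lebesgueNorm_le hab hK hM hK0 hM0 hKne hp hMp hγ hγp hle,
    exists_solution_of_integral_lt hab hK hM hK0 hM0⟩
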